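/- **Setting.** Let $M$ be a connected paracompact Hausdorff smooth $n$-manifold with cotangent bundle $\pi:T^*M\to M$, Liouville form $\varsigma(\ell)=\ell\circ\pi_*$ and canonical symplectic form $\sigma=\sum_i dp_i\wedge dq_i$. Let $J\subseteq\mathbb R$ be an open interval with $0\in J$, let $V\subseteq M$ be open and contractible, let $\alpha$ be a real function on $M$ that is smooth on $V$, and let $\Lambda=\{d\alpha(q):q\in V\}\subset T^*M$ be the graph of $d\alpha$ over $V$. Let $\mathcal O\supseteq\Lambda$ be open in $T^*M$ and let $H:J\times\mathcal O\to\mathbb R$, $H_t=H(t,\cdot)$, be such that for almost every $t\in J$ the function $H_t$ is differentiable on $\mathcal O$; its Hamiltonian vector field $\vec H_t$ is defined by $\langle dH_t(\ell),\cdot\rangle=\sigma_\ell(\cdot,\vec H_t(\ell))$. "Lipschitz" below means Lipschitz near each point, for the distances of charts or, equivalently, of any Riemannian metrics. Assume the following. 1. There is a Lipschitz map $\mathcal H:J\times\Lambda\to T^*M$, $\mathcal H_t=\mathcal H(t,\cdot)$, with values in $\mathcal O$, that is the flow of $\vec H_t$: for every $\ell\in\Lambda$, $\mathcal H_0(\ell)=\ell$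 and $\partial_t\mathcal H_t(\ell)=\vec H_t(\mathcal H_t(\ell))$ for a.e. $t\in J$. 2. The function $G(t,\ell)=\langle\mathcal H_t(\ell),\pi_*\vec H_t(\mathcal H_t(\ell))\rangle-H_t(\mathcal H_t(\ell))$ is Lipschitz–Carathéodory on $J\times\Lambda$: for a.e. $t$ the map $G(t,\cdot)$ is locally Lipschitz; for every $\ell$ the map $G(\cdot,\ell)$ is measurable and (essentially) bounded; and every point of $\Lambda$ has a neighbourhood in $\Lambda$ on which, for a.e. $t$, $G(t,\cdot)$ is Lipschitz with a constant $m(t)$, where $m$ is measurable and essentially bounded on $J$. Put $$\theta_t(\ell)=\alpha(\pi(\ell))+\int_0^t G(s,\ell)\,ds,\qquad t\in J,\ \ell\in\Lambda .$$ **Lemma.** Let $t\in J$ be such that $\pi\mathcal H_t:=\pi\circ\mathcal H_t$ is bi-Lipschitz on $\Lambda$, i.e. a homeomorphism of $\Lambda$ onto $S:=\pi\mathcal H_t(\Lambda)\subseteq M$ that is Lipschitz with Lipschitz inverse $(\pi\mathcal H_t)^{-1}:S\to\Lambda$. Let $\alpha_t:=\theta_t\circ(\pi\mathcal H_t)^{-1}:S\to\mathbb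 R$. Differentials and the class $C^1$ on $S$ are taken relative to $S$ (by invariance of domain $S$ is open in $M$, so these are the usual ones). Then: (i) $\alpha_t$ is differentiable on $S$ and $d\alpha_t(x)=\mathcal H_t\big((\pi\mathcal H_t)^{-1}(x)\big)$ for every $x\in S$; (ii) $\alpha_t$ is a $C^1$ function on $S$; (iii) $\Lambda_t:=\mathcal H_t(\Lambda)$ is the graph $\{d\alpha_t(x):x\in S\}$ of $d\alpha_t$. -/

import Mathlib

open Set Filter MeasureTheory Bundle
open scoped Manifold Topology ContDiff NNReal ENNReal

noncomputable section

/-! ### The cotangent bundle and its canonical structures -/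

/-- The model space `ℝⁿ` of the state manifold. -/
abbrev Model (n : ℕ) : Type := EuclideanSpace ℝ (Fin n)

/-- The cotangent bundle `T*M` of an `n`-dimensional manifold: pairs of a point `x` and a linear
form on `T_x M`. Its topology and its manifold structure are those of Mathlib's bundle of
homomorphisms from the tangent bundle to the trivial line bundle. -/
abbrev Cotangent (n : ℕ) (M : Type*) [TopologicalSpace M] [ChartedSpace (Model n) M] :=
  TotalSpace (Model n →L[ℝ] ℝ)
    (fun x : M => TangentSpace (𝓡 n) x →L[ℝ] Bundle.Trivial M ℝ x)

/-- The model of `T*M`: pairs `(q, p)` in `ℝⁿ × (ℝⁿ)*`. -/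
abbrev cotModel (n : ℕ) :
    ModelWithCorners ℝ (Model n × (Model n →L[ℝ] ℝ)) (ModelProd (Model n) (Model n →L[ℝ] ℝ)) :=
  (𝓡 n).prod 𝓘(ℝ, Model n →L[ℝ] ℝ)

section Symplectic

variable {n : ℕ} {M : Type*} [TopologicalSpace M] [ChartedSpace (Model n) M]
  [IsManifold (𝓡 n) ∞ M]

/-- The differential at `ℓ` of the canonical coordinates `(q, p)` of `T*M` around `ℓ`, induced by
the preferred chart `q` of `M` at the base point of `ℓ`: in this chart of `T*M` a covector `ω` over
`x` has the coordinates `(q(x), ω ∘ (dq_x)⁻¹)`. -/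
def dCoord (ℓ : Cotangent n M) :
    TangentSpace (cotModel n) ℓ →L[ℝ] (Model n × (Model n →L[ℝ] ℝ)) :=
  mfderiv (cotModel n) 𝓘(ℝ, Model n × (Model n →L[ℝ] ℝ)) (extChartAt (cotModel n) ℓ) ℓ

/-- The canonical symplectic form `σ = ∑ᵢ dpᵢ ∧ dqᵢ` on `T*M`:
`σ_ℓ(v, w) = ⟨dp(v), dq(w)⟩ - ⟨dp(w), dq(v)⟩`. -/
def symplecticForm (ℓ : Cotangent n M) (v w : TangentSpace (cotModel n) ℓ) : ℝ :=
  (dCoord ℓ v).2 (dCoord ℓ w).1 - (dCoord ℓ w).2 (dCoord ℓ v).1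

/-- The Liouville form `ς(ℓ) = ℓ ∘ π_*` on `T*M`. -/
def liouvilleForm (ℓ : Cotangent n M) (v : TangentSpace (cotModel n) ℓ) : ℝ :=
  ℓ.2 (mfderiv (cotModel n) (𝓡 n) (fun k : Cotangent n M => k.proj) ℓ v)

/-- The symplectic form is non-degenerate: every linear form on `T_ℓ(T*M)` is `σ_ℓ(·, X)` for a
unique tangent vector `X`. -/
theorem existsUnique_symplecticForm (ℓ : Cotangent n M)
    (η : TangentSpace (cotModel n) ℓ →L[ℝ] ℝ) :
    ∃! X : TangentSpace (cotModel n) ℓ, ∀ v, η v = symplecticForm ℓ v X := by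
  obtain ⟨e, he⟩ : (dCoord ℓ).IsInvertible :=
    isInvertible_mfderiv_extChartAt (mem_extChartAt_source ℓ)
  have heA : ∀ v, dCoord ℓ v = e v := fun v => by rw [← he]; rfl
  let g : (Model n × (Model n →L[ℝ] ℝ)) →L[ℝ] ℝ := η.comp e.symm.toContinuousLinearMap
  have hg : ∀ v, η v = g (e v) := fun v => by simp [g]
  let D := InnerProductSpace.toDual ℝ (Model n)
  let r : Model n →L[ℝ] ℝ :=
    (g.comp (ContinuousLinearMap.inr ℝ (Model n) (Model n →L[ℝ] ℝ))).comp
      D.toContinuousLinearEquiv.toContinuousLinearMap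
  let a : Model n := D.symm r
  let b : Model n →L[ℝ] ℝ := -(g.comp (ContinuousLinearMap.inl ℝ (Model n) (Model n →L[ℝ] ℝ)))
  have hp : ∀ y : Model n →L[ℝ] ℝ, g (0, y) = y a := by
    intro y
    have h1 : r (D.symm y) = g (0, y) := by simp [r]
    have h2 : r (D.symm y) = inner ℝ a (D.symm y) :=
      (InnerProductSpace.toDual_symm_apply).symm
    have h3 : y a = inner ℝ (D.symm y) a := (InnerProductSpace.toDual_symm_apply).symm
    rw [← h1, h2, h3, real_inner_comm]
  have hgen : ∀ z : Model n × (Model n →L[ℝ] ℝ), g z = z.2 a - b z.1 := by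
    rintro ⟨x, y⟩
    have : ((x, y) : Model n × (Model n →L[ℝ] ℝ)) = (x, 0) + (0, y) := by simp
    rw [this, map_add, hp]
    simp [b, add_comm]
  refine ⟨e.symm (a, b), fun v => ?_, fun X hX => ?_⟩
  · rw [hg, hgen]
    simp [symplecticForm, heA]
  · have key : ∀ z : Model n × (Model n →L[ℝ] ℝ),
        z.2 a - b z.1 = z.2 (e X).1 - (e X).2 z.1 := by
      intro z
      have h := hX (e.symm z)
      rw [hg, hgen] at h
      simpa [symplecticForm, heA] using h
    have h1 : (e X).1 = a := by
      refine ext_inner_left ℝ fun w => ?_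
      have := key (0, D w)
      simpa [D] using this.symm
    have h2 : (e X).2 = b := by
      ext w
      have := key (w, 0)
      simpa using this.symm
    rw [← e.symm_apply_apply X, ← h1, ← h2]

/-- The differential of a real function on `T*M`. -/
def dFun (h : Cotangent n M → ℝ) (ℓ : Cotangent n M) : TangentSpace (cotModel n) ℓ →L[ℝ] ℝ :=
  mfderiv (cotModel n) 𝓘(ℝ, ℝ) h ℓ

/-- The Hamiltonian vector field of `h`: the unique vector field with
`⟨dh(ℓ), ·⟩ = σ_ℓ(·, hamiltonianField h ℓ)` (meaningful where `h` is differentiable). -/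
def hamiltonianField (h : Cotangent n M → ℝ) (ℓ : Cotangent n M) :
    TangentSpace (cotModel n) ℓ :=
  (existsUnique_symplecticForm ℓ (dFun h ℓ)).choose

theorem hamiltonianField_spec (h : Cotangent n M → ℝ) (ℓ : Cotangent n M)
    (v : TangentSpace (cotModel n) ℓ) :
    dFun h ℓ v = symplecticForm ℓ v (hamiltonianField h ℓ) :=
  (existsUnique_symplecticForm ℓ (dFun h ℓ)).choose_spec.1 v

/-- The differential of `f` at `x`, as a point of `T*M` over `x`, for a real function `f` on a
subset `s` of `M`. The differential is taken relative to `s`; at a point where `s` is a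
neighbourhood it is the usual differential. -/
def dSection (f : M → ℝ) (s : Set M) (x : M) : Cotangent n M :=
  ⟨x, mfderivWithin (𝓡 n) 𝓘(ℝ, ℝ) f s x⟩

/-- The graph of `df` over `s`, a subset of `T*M`. -/
def graphOfDifferential (f : M → ℝ) (s : Set M) : Set (Cotangent n M) :=
  dSection f s '' s

instance [Nonempty M] : Nonempty (Cotangent n M) :=
  ⟨⟨Classical.arbitrary M, 0⟩⟩

end Symplectic

/-! ### Lipschitz maps between manifolds -/

section Lipschitz

variable {E H X E' H' Y : Type*}
  [NormedAddCommGroup E] [NormedSpace ℝ E] [TopologicalSpace H]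
  [NormedAddCommGroup E'] [NormedSpace ℝ E'] [TopologicalSpace H']
  [TopologicalSpace X] [ChartedSpace H X] [TopologicalSpace Y] [ChartedSpace H' Y]

/-- `f` is locally Lipschitz on the subset `s` of the manifold `X`: near each point of `s` it is
Lipschitz for the distances read in charts. On a smooth manifold the distance in a chart and the
distance of any Riemannian metric are comparable on a neighbourhood of each point, so this does not
depend on a choice of metrics, and it holds for every map that is Lipschitz for Riemannian
distances. -/
def LocLipschitzOn (I : ModelWithCorners ℝ E H) (I' : ModelWithCorners ℝ E' H')
    (f : X → Y) (s : Set X) : Prop :=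
  ∀ x ∈ s, ContinuousWithinAt f s x ∧ ∃ U ∈ 𝓝[s] x, ∃ C : ℝ≥0, ∀ y ∈ U, ∀ z ∈ U,
    dist (extChartAt I' (f x) (f y)) (extChartAt I' (f x) (f z)) ≤
      C * dist (extChartAt I x y) (extChartAt I x z)

/-- `f` is a homeomorphism of `s` onto `f(s)` that is (locally) Lipschitz with a (locally)
Lipschitz inverse. -/
structure IsBiLipschitzOn [Nonempty X] (I : ModelWithCorners ℝ E H)
    (I' : ModelWithCorners ℝ E' H') (f : X → Y) (s : Set X) : Prop where
  injOn : InjOn f s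
  lipschitz : LocLipschitzOn I I' f s
  lipschitz_inv : LocLipschitzOn I' I (Function.invFunOn f s) (f '' s)

/-- Lipschitz-Carathéodory functions `G : J × s → ℝ`, where `s` is a subset of a manifold. Equalities
and bounds in `t` are understood almost everywhere; the last condition, on compact
sets, is stated in its local form, with the distance of a chart. -/
structure LipschitzCaratheodoryOn (I : ModelWithCorners ℝ E H) (J : Set ℝ) (s : Set X)
    (G : ℝ → X → ℝ) : Prop where
  locLipschitz : ∀ᵐ t ∂(volume.restrict J), LocLipschitzOn I 𝓘(ℝ, ℝ) (G t) s
  bounded_measurable : ∀ x ∈ s, MemLp (fun t => G t x) ∞ (volume.restrict J)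
  lipschitz_bound : ∀ x ∈ s, ∃ U ∈ 𝓝[s] x, ∃ m : ℝ → ℝ, MemLp m ∞ (volume.restrict J) ∧
    ∀ᵐ t ∂(volume.restrict J), ∀ y ∈ U, ∀ z ∈ U,
      |G t y - G t z| ≤ m t * dist (extChartAt I x y) (extChartAt I x z)

end Lipschitz

/-! ### The Hamiltonian flow and the Cartan form -/

section Flow

variable {n : ℕ} {M : Type*} [TopologicalSpace M] [ChartedSpace (Model n) M]
  [IsManifold (𝓡 n) ∞ M]

/-- `Φ : J × Λ → T*M` is the flow of the Hamiltonian vector field `X_t` of `H_t` on the open set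
`O`: it stays in `O`, and `Φ_0(ℓ) = ℓ` and `∂_t Φ_t(ℓ) = X_t(Φ_t(ℓ))` for almost every `t`. (Absolute
continuity in `t` is contained in the Lipschitz continuity of `Φ`, which is assumed separately.) -/
structure IsHamiltonianFlow (J : Set ℝ) (O Λ : Set (Cotangent n M)) (H : ℝ → Cotangent n M → ℝ)
    (Φ : ℝ → Cotangent n M → Cotangent n M) : Prop where
  mem : ∀ t ∈ J, ∀ ℓ ∈ Λ, Φ t ℓ ∈ O
  initial : ∀ ℓ ∈ Λ, Φ 0 ℓ = ℓ
  hasDeriv : ∀ ℓ ∈ Λ, ∀ᵐ t ∂(volume.restrict J),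
    HasMFDerivAt 𝓘(ℝ, ℝ) (cotModel n) (fun s => Φ s ℓ) t
      ((1 : ℝ →L[ℝ] ℝ).smulRight (hamiltonianField (H t) (Φ t ℓ)))

/-- The Cartan form `ς - H dt` on the velocity of the flow:
`⟨Φ_t(ℓ), π_* X_t(Φ_t(ℓ))⟩ - H_t(Φ_t(ℓ))`, where `X_t` is the Hamiltonian vector field of `H_t`. -/
def cartanIntegrand (H : ℝ → Cotangent n M → ℝ) (Φ : ℝ → Cotangent n M → Cotangent n M)
    (t : ℝ) (ℓ : Cotangent n M) : ℝ :=
  liouvilleForm (Φ t ℓ) (hamiltonianField (H t) (Φ t ℓ)) - H t (Φ t ℓ)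

/-- The function `θ(t, ℓ) = α(π(ℓ)) + ∫₀ᵗ ⟨Φ_s(ℓ), π_* X_s(Φ_s(ℓ))⟩ - H_s(Φ_s(ℓ)) ds`. -/
def theta (α : M → ℝ) (H : ℝ → Cotangent n M → ℝ) (Φ : ℝ → Cotangent n M → Cotangent n M)
    (t : ℝ) (ℓ : Cotangent n M) : ℝ :=
  α ℓ.proj + ∫ s in (0 : ℝ)..t, cartanIntegrand H Φ s ℓ

/-- The standing regularity assumption: `Φ` is the flow of the Hamiltonian vector field of `H` from
`Λ`, it is Lipschitz continuous on `J × Λ`, and the Cartan form along the flow is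
Lipschitz-Carathéodory. That `H_t` has a Hamiltonian vector field on `O` means that it is
differentiable there. -/
structure RegularHamiltonianFlow (J : Set ℝ) (O Λ : Set (Cotangent n M))
    (H : ℝ → Cotangent n M → ℝ) (Φ : ℝ → Cotangent n M → Cotangent n M) : Prop where
  differentiable : ∀ᵐ t ∂(volume.restrict J), ∀ ℓ ∈ O,
    MDifferentiableAt (cotModel n) 𝓘(ℝ, ℝ) (H t) ℓ
  flow : IsHamiltonianFlow J O Λ H Φ
  lipschitz : LocLipschitzOn (𝓘(ℝ, ℝ).prod (cotModel n)) (cotModel n)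
    (fun z : ℝ × Cotangent n M => Φ z.1 z.2) (J ×ˢ Λ)
  caratheodory : LipschitzCaratheodoryOn (cotModel n) J Λ (cartanIntegrand H Φ)

/-- The projected flow `π ∘ Φ_t : T*M → M`. -/
def projFlow (Φ : ℝ → Cotangent n M → Cotangent n M) (t : ℝ) (ℓ : Cotangent n M) : M :=
  (Φ t ℓ).proj

/-- The function `α_t = θ_t ∘ (π ∘ Φ_t)⁻¹` on `π(Φ_t(Λ))`, where `π ∘ Φ_t` is inverted on `Λ`. -/
def alphaT [Nonempty M] (α : M → ℝ) (H : ℝ → Cotangent n M → ℝ)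
    (Φ : ℝ → Cotangent n M → Cotangent n M) (Λ : Set (Cotangent n M)) (t : ℝ) (x : M) : ℝ :=
  theta α H Φ t (Function.invFunOn (projFlow Φ t) Λ x)

end Flow

end

noncomputable section

/-! ### The fundamental theorem of calculus for pointwise Lipschitz functions -/

section Calculus

/-! The heart of the matter is the identity `dθ_t = Φ_t^* ς` on `Λ`. In local coordinates, with `u`
a parameter of `Λ` and `(x_t, p_t)` the canonical coordinates of `Φ_t`, it says that `θ_t(v) -
θ_t(u) = p_t(u)(x_t(v) - x_t(u)) + o(|v - u|)`; this is `IsPrimitiveAt`. Substituting the Lipschitz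
inverse of `π ∘ Φ_t` turns the error into `o(|x - y|)` on the base, so `α_t` has differential `p_t`
there. This covector depends continuously on the point, which gives the class `C^1` and the
description of the graph.

For a smooth flow the identity follows from Cartan's formula `d/ds (Φ_s^* ς) = d(ς(X_s) - H_s)`
pulled back by `Φ_s`, and from `ς = d(α ∘ π)` on the graph of `dα`. Here `Φ` is only Lipschitz, so
the formula is proved in integrated form. Along a segment of initial values the integral of `p dx`
is a Lipschitz function of time on compact intervals, and its derivative is computed almost
everywhere (`hasDerivAt_actionIntegral`). Hamilton's equations express the part coming from `dp ∧
dx` as an increment of the energy. Fubini handles exceptional times that depend on the initial point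
(`integral_sub_eq_actionIntegral_sub`). Hence the increment of `θ_s` minus the integral of `p dx` is
constant in time (`theta_sub_sub_eq_segmentAction_sub`).

The passage between the infinitesimal and the integrated identity is made by `sub_eq_segmentAction`
and `isLittleO_of_sub_eq_segmentAction`; the second uses that `p` is Lipschitz, which makes the
error quadratic. A chart of `T*M` is available only for short times, so the identity is propagated
as a property of germs at a point of `V`, and connectedness of `J` gives it for all times
(`thetaIsPrimitive`).

Differentials on the image are relative to it, so their uniqueness is needed. Instead of invariance
of domain a measure argument is used: a bi-Lipschitz image of a ball cannot be squeezed into thin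
neighbourhoods of a hyperplane (`uniqueDiffWithinAt_image_ball`). -/

theorem sub_le_integral_of_forall_eventually_slope_le {g φ : ℝ → ℝ} {a b : ℝ} (hab : a ≤ b)
    (hcont : ContinuousOn g (Icc a b)) (φint : IntegrableOn φ (Icc a b))
    (hφg : ∀ x ∈ Ico a b, ∀ y, φ x < y → ∀ᶠ u in 𝓝[>] x, g u - g x ≤ (u - x) * y) :
    g b - g a ≤ ∫ y in a..b, φ y := by
  refine le_of_forall_pos_le_add fun ε εpos => ?_
  -- Vitali–Carathéodory: a lower semicontinuous function strictly above `φ` costs less than `ε` in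
  -- the integral. Its semicontinuity replaces continuity of `φ`, since a lower bound at `t`
  -- persists near `t`.
  rcases exists_lt_lowerSemicontinuous_integral_lt φ φint εpos with
    ⟨G', f_lt_G', G'cont, G'int, G'lt_top, hG'⟩
  set s := {t | g t - g a ≤ ∫ u in a..t, (G' u).toReal} ∩ Icc a b
  have s_closed : IsClosed s := by
    have : ContinuousOn (fun t => (g t - g a, ∫ u in a..t, (G' u).toReal)) (Icc a b) := by
      rw [← uIcc_of_le hab] at G'int hcont ⊢
      exact (hcont.sub continuousOn_const).prodMk
        (intervalIntegral.continuousOn_primitive_interval G'int)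
    simp only [s, inter_comm]
    exact this.preimage_isClosed_of_isClosed isClosed_Icc OrderClosedTopology.isClosed_le'
  -- Continuous induction: the inequality is a closed condition and always extends a little to the
  -- right.
  have main : Icc a b ⊆ {t | g t - g a ≤ ∫ u in a..t, (G' u).toReal} := by
    refine s_closed.Icc_subset_of_forall_exists_gt
      (by simp only [intervalIntegral.integral_same, mem_ofPred_eq, sub_self, le_rfl])
      fun t ht v t_lt_v => ?_
    obtain ⟨y, g'_lt_y', y_lt_G'⟩ : ∃ y : ℝ, (φ t : EReal) < y ∧ (y : EReal) < G' t :=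
      EReal.lt_iff_exists_real_btwn.1 (f_lt_G' t)
    have I1 : ∀ᶠ u in 𝓝[>] t, (u - t) * y ≤ ∫ w in t..u, (G' w).toReal := by
      have B : ∀ᶠ u in 𝓝 t, (y : EReal) < G' u := G'cont.lowerSemicontinuousAt _ _ y_lt_G'
      rcases mem_nhds_iff_exists_Ioo_subset.1 B with ⟨m, M, ⟨hm, hM⟩, H⟩
      have : Ioo t (min M b) ∈ 𝓝[>] t := Ioo_mem_nhdsGT (lt_min hM ht.right.right)
      filter_upwards [this] with u hu
      have I : Icc t u ⊆ Icc a b := Icc_subset_Icc ht.2.1 (hu.2.le.trans (min_le_right _ _))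
      calc
        (u - t) * y = ∫ _ in Icc t u, y := by
          simp only [MeasureTheory.integral_const, MeasurableSet.univ, measureReal_restrict_apply,
            univ_inter, hu.left.le, Real.volume_real_Icc_of_le, smul_eq_mul]
        _ ≤ ∫ w in t..u, (G' w).toReal := by
          rw [intervalIntegral.integral_of_le hu.1.le, ← integral_Icc_eq_integral_Ioc]
          apply setIntegral_mono_ae_restrict
          · simp
          · exact IntegrableOn.mono_set G'int I
          · have C1 : ∀ᵐ x : ℝ ∂volume.restrict (Icc t u), G' x < (⊤ : EReal) :=
              ae_mono (Measure.restrict_mono I le_rfl) G'lt_top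
            have C2 : ∀ᵐ x : ℝ ∂volume.restrict (Icc t u), x ∈ Icc t u :=
              ae_restrict_mem measurableSet_Icc
            filter_upwards [C1, C2] with x G'x hx
            apply EReal.coe_le_coe_iff.1
            have : x ∈ Ioo m M := by
              simp only [hm.trans_le hx.left,
                (hx.right.trans_lt hu.right).trans_le (min_le_left M b), mem_Ioo, and_self_iff]
            refine (H this).out.le.trans_eq ?_
            exact (EReal.coe_toReal G'x.ne (f_lt_G' x).ne_bot).symm
    have I2 : ∀ᶠ u in 𝓝[>] t, g u - g t ≤ (u - t) * y :=
      hφg t ⟨ht.2.1, ht.2.2⟩ y (EReal.coe_lt_coe_iff.1 g'_lt_y')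
    have I3 : ∀ᶠ u in 𝓝[>] t, g u - g t ≤ ∫ w in t..u, (G' w).toReal := by
      filter_upwards [I1, I2] with u hu1 hu2 using hu2.trans hu1
    have I4 : ∀ᶠ u in 𝓝[>] t, u ∈ Ioc t (min v b) := Ioc_mem_nhdsGT <| lt_min t_lt_v ht.2.2
    rcases (I3.and I4).exists with ⟨x, hx, h'x⟩
    refine ⟨x, ?_, Ioc_subset_Ioc le_rfl (min_le_left _ _) h'x⟩
    calc
      g x - g a = g t - g a + (g x - g t) := by abel
      _ ≤ (∫ w in a..t, (G' w).toReal) + ∫ w in t..x, (G' w).toReal := add_le_add ht.1 hx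
      _ = ∫ w in a..x, (G' w).toReal := by
        apply intervalIntegral.integral_add_adjacent_intervals
        · rw [intervalIntegrable_iff_integrableOn_Ioc_of_le ht.2.1]
          exact IntegrableOn.mono_set G'int
            (Ioc_subset_Icc_self.trans (Icc_subset_Icc le_rfl ht.2.2.le))
        · rw [intervalIntegrable_iff_integrableOn_Ioc_of_le h'x.1.le]
          exact IntegrableOn.mono_set G'int
            (Ioc_subset_Icc_self.trans (Icc_subset_Icc ht.2.1 (h'x.2.trans (min_le_right _ _))))
  calc
    g b - g a ≤ ∫ y in a..b, (G' y).toReal := main (right_mem_Icc.2 hab)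
    _ ≤ (∫ y in a..b, φ y) + ε := by
      convert! hG'.le <;>
        · rw [intervalIntegral.integral_of_le hab]
          simp only [integral_Icc_eq_integral_Ioc', Real.volume_singleton]

/-- A continuous function on `[a, b]` with finite Dini derivates at every point and an integrable
derivative almost everywhere is the primitive of its derivative. -/
theorem integral_eq_sub_of_isBigO_of_ae_hasDerivAt {g g' : ℝ → ℝ} {a b : ℝ} (hab : a ≤ b)
    (hcont : ContinuousOn g (Icc a b))
    (hO : ∀ x ∈ Ico a b, (fun u => g u - g x) =O[𝓝[>] x] fun u => u - x)
    (hint : IntegrableOn g' (Icc a b))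
    (hd : ∀ᵐ x ∂(volume.restrict (Icc a b)), HasDerivWithinAt g (g' x) (Ioi x) x) :
    ∫ y in a..b, g' y = g b - g a := by
  classical
  have key : ∀ (f f' : ℝ → ℝ), ContinuousOn f (Icc a b) →
      (∀ x ∈ Ico a b, (fun u => f u - f x) =O[𝓝[>] x] fun u => u - x) →
      IntegrableOn f' (Icc a b) →
      (∀ᵐ x ∂(volume.restrict (Icc a b)), HasDerivWithinAt f (f' x) (Ioi x) x) →
      f b - f a ≤ ∫ y in a..b, f' y := by
    intro f f' hcont hO hint hd
    have : ∀ x, ∃ c : ℝ, x ∈ Ico a b → ∀ᶠ u in 𝓝[>] x, f u - f x ≤ (u - x) * c := by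
      intro x
      by_cases hx : x ∈ Ico a b
      · obtain ⟨c, hc⟩ := (hO x hx).bound
        refine ⟨c, fun _ => ?_⟩
        filter_upwards [hc, self_mem_nhdsWithin] with u hu hxu
        have hxu : x < u := hxu
        rw [Real.norm_eq_abs, Real.norm_eq_abs, abs_of_pos (sub_pos.2 hxu)] at hu
        rw [mul_comm]
        exact (le_abs_self _).trans hu
      · exact ⟨0, fun h => absurd h hx⟩
    choose c hc using this
    -- On the null set without the prescribed derivative, a finite bound for the right difference
    -- quotients is used instead. The slope condition then holds at every point and the integral is
    -- unchanged.
    let φ : ℝ → ℝ := fun x => if HasDerivWithinAt f (f' x) (Ioi x) x then f' x else c x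
    have hφ : f' =ᵐ[volume.restrict (Icc a b)] φ := by
      filter_upwards [hd] with x hx
      exact (if_pos hx).symm
    have hle := sub_le_integral_of_forall_eventually_slope_le hab hcont (hint.congr hφ) ?_
    · refine hle.trans_eq ?_
      rw [intervalIntegral.integral_of_le hab, intervalIntegral.integral_of_le hab,
        ← integral_Icc_eq_integral_Ioc, ← integral_Icc_eq_integral_Ioc]
      exact (integral_congr_ae hφ).symm
    · intro x hx y hy
      by_cases h : HasDerivWithinAt f (f' x) (Ioi x) x
      · have hy' : f' x < y := (if_pos h).symm.trans_lt hy
        filter_upwards [h.limsup_slope_le' (notMem_Ioi.2 le_rfl) hy', self_mem_nhdsWithin]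
          with u hu t_lt_u
        have := mul_le_mul_of_nonneg_left hu.le (sub_pos.2 t_lt_u.out).le
        rwa [← smul_eq_mul, sub_smul_slope] at this
      · have hy' : c x < y := (if_neg h).symm.trans_lt hy
        filter_upwards [hc x hx, self_mem_nhdsWithin] with u hu hxu
        have hxu : x < u := hxu
        exact hu.trans (mul_le_mul_of_nonneg_left hy'.le (sub_pos.2 hxu).le)
  -- The reverse inequality is the same one for `-g`.
  refine le_antisymm ?_ (key g g' hcont hO hint hd)
  have := key (fun x => -g x) (fun x => -g' x) hcont.neg ?_ hint.neg ?_
  · rw [intervalIntegral.integral_neg] at this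
    linarith
  · intro x hx
    refine (hO x hx).neg_left.congr_left fun u => ?_
    ring
  · filter_upwards [hd] with x hx using hx.neg

end Calculus

/-! ### Pairings of Lipschitz curves: integration by parts and weak convergence of derivatives -/

section Pairing

variable {F : Type*} [NormedAddCommGroup F] [NormedSpace ℝ F] [FiniteDimensional ℝ F]

omit [FiniteDimensional ℝ F] in
theorem aestronglyMeasurable_pairing {X : Type*} [MeasurableSpace X] {μ : Measure X}
    {q : X → F →L[ℝ] ℝ} {v : X → F} (hq : AEStronglyMeasurable q μ)
    (hv : AEStronglyMeasurable v μ) : AEStronglyMeasurable (fun a => q a (v a)) μ :=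
  isBoundedBilinearMap_apply.continuous.comp_aestronglyMeasurable (hq.prodMk hv)

omit [FiniteDimensional ℝ F] in
theorem norm_pairing_le {q : F →L[ℝ] ℝ} {v : F} {A B : ℝ} (hq : ‖q‖ ≤ A) (hv : ‖v‖ ≤ B) :
    ‖q v‖ ≤ A * B :=
  (q.le_opNorm v).trans (mul_le_mul hq hv (norm_nonneg _) ((norm_nonneg _).trans hq))

theorem intervalIntegrable_of_bounded {E : Type*} [NormedAddCommGroup E] {f : ℝ → E} {a b C : ℝ}
    (hf : AEStronglyMeasurable f volume) (hC : ∀ x ∈ uIcc a b, ‖f x‖ ≤ C) :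
    IntervalIntegrable f volume a b := by
  refine (intervalIntegrable_const (c := C)).mono_fun hf.restrict ?_
  rw [EventuallyLE, ae_restrict_iff' measurableSet_uIoc]
  exact ae_of_all _ fun x hx => (hC x (uIoc_subset_uIcc hx)).trans (le_abs_self C)

theorem LipschitzWith.isBigO_sub {E : Type*} [NormedAddCommGroup E] {C : ℝ≥0} {f : ℝ → E}
    (hf : LipschitzWith C f) (l : Filter ℝ) (x : ℝ) :
    (fun u => f u - f x) =O[l] fun u => u - x :=
  Asymptotics.IsBigO.of_bound C (Eventually.of_forall fun u => hf.norm_sub_le u x)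

theorem LipschitzWith.intervalIntegrable_pairing_deriv {C : ℝ≥0} {q : ℝ → F →L[ℝ] ℝ} {y : ℝ → F}
    (hq : Continuous q) (hy : LipschitzWith C y) (a b : ℝ) :
    IntervalIntegrable (fun τ => q τ (deriv y τ)) volume a b := by
  obtain ⟨A, hA⟩ := isCompact_uIcc.exists_bound_of_continuousOn (hq.continuousOn (s := uIcc a b))
  exact intervalIntegrable_of_bounded (C := A * C)
    (aestronglyMeasurable_pairing hq.aestronglyMeasurable (aestronglyMeasurable_deriv _ _))
    fun x hx => norm_pairing_le (hA x hx) (norm_deriv_le_of_lipschitz hy)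

theorem LipschitzWith.intervalIntegrable_deriv_pairing {C : ℝ≥0} {q : ℝ → F →L[ℝ] ℝ} {y : ℝ → F}
    (hq : LipschitzWith C q) (hy : Continuous y) (a b : ℝ) :
    IntervalIntegrable (fun τ => deriv q τ (y τ)) volume a b := by
  obtain ⟨A, hA⟩ := isCompact_uIcc.exists_bound_of_continuousOn (hy.continuousOn (s := uIcc a b))
  exact intervalIntegrable_of_bounded (C := C * A)
    (aestronglyMeasurable_pairing (aestronglyMeasurable_deriv _ _) hy.aestronglyMeasurable)
    fun x hx => norm_pairing_le (norm_deriv_le_of_lipschitz hq) (hA x hx)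

/-- The pairing of two Lipschitz curves has finite Dini derivates everywhere, and by Rademacher the
product rule holds almost everywhere; so it is the primitive of its derivative. -/
theorem integral_pairing_deriv_eq {C D : ℝ≥0} {q : ℝ → F →L[ℝ] ℝ} {y : ℝ → F}
    (hq : LipschitzWith C q) (hy : LipschitzWith D y) {a b : ℝ} (hab : a ≤ b) :
    ∫ τ in a..b, q τ (deriv y τ) =
      q b (y b) - q a (y a) - ∫ τ in a..b, deriv q τ (y τ) := by
  have h1 := hy.intervalIntegrable_pairing_deriv hq.continuous a b
  have h2 := hq.intervalIntegrable_deriv_pairing hy.continuous a b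
  rw [eq_sub_iff_add_eq, add_comm, ← intervalIntegral.integral_add h2 h1]
  refine integral_eq_sub_of_isBigO_of_ae_hasDerivAt (g := fun τ => q τ (y τ)) hab
    (hq.continuous.clm_apply hy.continuous).continuousOn ?_
    ((intervalIntegrable_iff_integrableOn_Icc_of_le hab).1 (h2.add h1)) ?_
  · intro x _
    have hb : (fun u => y u) =O[𝓝[>] x] fun _ => (1 : ℝ) :=
      (hy.continuous.tendsto x).mono_left nhdsWithin_le_nhds |>.isBigO_one ℝ
    have e1 : (fun u => (q u - q x) (y u)) =O[𝓝[>] x] fun u => u - x := by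
      have := (hq.isBigO_sub (𝓝[>] x) x).norm_left.mul hb.norm_left
      simp only [mul_one] at this
      exact (Asymptotics.IsBigO.of_bound 1 (Eventually.of_forall fun u => by
        rw [one_mul, norm_mul, norm_norm, norm_norm]; exact (q u - q x).le_opNorm _)).trans this
    have e2 : (fun u => q x (y u - y x)) =O[𝓝[>] x] fun u => u - x :=
      ((q x).isBigO_comp _ _).trans (hy.isBigO_sub _ x)
    refine (e1.add e2).congr_left fun u => ?_
    simp
  · filter_upwards [ae_restrict_of_ae hq.ae_differentiableAt_real,
      ae_restrict_of_ae hy.ae_differentiableAt_real] with x h1 h2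
    exact (h1.hasDerivAt.clm_apply h2.hasDerivAt).hasDerivWithinAt

/-- Derivatives of uniformly Lipschitz functions that tend to zero tend weakly to zero. -/
theorem tendsto_integral_pairing_deriv_zero {ι : Type*} {l : Filter ι} [l.IsCountablyGenerated]
    {C : ℝ≥0} {A : ℝ} {h : ι → ℝ → F} {g : ℝ → F →L[ℝ] ℝ} (hh : ∀ i, LipschitzWith C (h i))
    (h0 : ∀ τ, Tendsto (fun i => h i τ) l (𝓝 0)) (hg : AEStronglyMeasurable g volume)
    (hA : ∀ τ, ‖g τ‖ ≤ A) :
    Tendsto (fun i => ∫ τ in (0 : ℝ)..1, g τ (deriv (h i) τ)) l (𝓝 0) := by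
  have hgm : MemLp g 1 (volume.restrict (Ioc (0 : ℝ) 1)) :=
    MemLp.of_bound hg.restrict A (Eventually.of_forall hA)
  rw [Metric.tendsto_nhds]
  intro ε hε
  -- The error of an `L¹`-approximation of `g` is multiplied by at most `C`; the `+ 1` covers `C =
  -- 0`.
  have hη : 0 < ε / 2 / (C + 1) := by positivity
  obtain ⟨φ, hφc, hφs, hφ⟩ := hgm.exist_eLpNorm_sub_le ENNReal.one_ne_top le_rfl hη
  obtain ⟨D, hD⟩ := hφs.lipschitzWith_of_hasCompactSupport hφc (by simp)
  have hφ1 : ∫ τ in (0 : ℝ)..1, ‖g τ - φ τ‖ ≤ ε / 2 / (C + 1) := by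
    rw [intervalIntegral.integral_of_le zero_le_one]
    have hm : AEStronglyMeasurable (g - φ) (volume.restrict (Ioc (0 : ℝ) 1)) :=
      (hg.sub hφs.continuous.aestronglyMeasurable).restrict
    rw [eLpNorm_one_eq_lintegral_enorm] at hφ
    have := integral_norm_eq_lintegral_enorm hm
    simp only [Pi.sub_apply] at this
    rw [this]
    exact ENNReal.toReal_le_of_le_ofReal hη.le hφ
  -- For a smooth test function the derivative is moved from `h i` to `φ`, and `h i` itself tends to
  -- zero.
  have hφ0 : Tendsto (fun i => ∫ τ in (0 : ℝ)..1, φ τ (deriv (h i) τ)) l (𝓝 0) := by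
    have e : ∀ i, ∫ τ in (0 : ℝ)..1, φ τ (deriv (h i) τ) =
        φ 1 (h i 1) - φ 0 (h i 0) - ∫ τ in (0 : ℝ)..1, deriv φ τ (h i τ) := fun i =>
      integral_pairing_deriv_eq hD (hh i) zero_le_one
    simp only [e]
    have t1 := ((φ 1).continuous.tendsto 0).comp (h0 1)
    have t0 := ((φ 0).continuous.tendsto 0).comp (h0 0)
    have t2 : Tendsto (fun i => ∫ τ in (0 : ℝ)..1, deriv φ τ (h i τ)) l
        (𝓝 (∫ τ in (0 : ℝ)..1, (0 : ℝ))) := by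
      have hev : ∀ᶠ i in l, ‖h i 0‖ < 1 := by
        have := (h0 0).norm
        rw [norm_zero] at this
        exact this.eventually (gt_mem_nhds one_pos)
      refine intervalIntegral.tendsto_integral_filter_of_dominated_convergence
        (fun _ => D * (1 + C)) ?_ ?_ intervalIntegrable_const ?_
      · exact Eventually.of_forall fun i => (aestronglyMeasurable_pairing
          (aestronglyMeasurable_deriv _ _) (hh i).continuous.aestronglyMeasurable).restrict
      · filter_upwards [hev] with i hi
        refine ae_of_all _ fun τ hτ => ?_
        rw [uIoc_of_le zero_le_one] at hτ
        refine norm_pairing_le (norm_deriv_le_of_lipschitz hD) ?_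
        have h1 := (hh i).norm_sub_le τ 0
        have h2 : ‖τ - 0‖ ≤ 1 := by
          rw [sub_zero, Real.norm_eq_abs, abs_of_pos hτ.1]; exact hτ.2
        have h3 : ‖h i τ‖ ≤ ‖h i τ - h i 0‖ + ‖h i 0‖ := by
          simpa using norm_add_le (h i τ - h i 0) (h i 0)
        nlinarith [C.coe_nonneg]
      · refine ae_of_all _ fun τ _ => ?_
        have := ((deriv φ τ).continuous.tendsto 0).comp (h0 τ)
        simpa [Function.comp_def] using this
    simpa using (t1.sub t0).sub t2
  have hφ0' := Metric.tendsto_nhds.1 hφ0 (ε / 2) (half_pos hε)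
  filter_upwards [hφ0'] with i hi
  have i1 : IntervalIntegrable (fun τ => g τ (deriv (h i) τ)) volume 0 1 :=
    intervalIntegrable_of_bounded (C := A * C)
      (aestronglyMeasurable_pairing hg (aestronglyMeasurable_deriv _ _))
      fun x _ => norm_pairing_le (hA x) (norm_deriv_le_of_lipschitz (hh i))
  have i2 := (hh i).intervalIntegrable_pairing_deriv hφs.continuous 0 1
  have i3 : IntervalIntegrable (fun τ => ‖g τ - φ τ‖) volume 0 1 := by
    have : IntervalIntegrable (fun τ => g τ - φ τ) volume 0 1 :=
      (intervalIntegrable_of_bounded hg fun x _ => hA x).sub (hφs.continuous.intervalIntegrable _ _)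
    exact this.norm
  have e : ∫ τ in (0 : ℝ)..1, g τ (deriv (h i) τ) =
      (∫ τ in (0 : ℝ)..1, (g τ - φ τ) (deriv (h i) τ)) + ∫ τ in (0 : ℝ)..1, φ τ (deriv (h i) τ) := by
    rw [← sub_eq_iff_eq_add, ← intervalIntegral.integral_sub i1 i2]
    rfl
  have b : ‖∫ τ in (0 : ℝ)..1, (g τ - φ τ) (deriv (h i) τ)‖ ≤ ε / 2 / (C + 1) * C := by
    refine (intervalIntegral.norm_integral_le_of_norm_le zero_le_one (g := fun τ => ‖g τ - φ τ‖ * C)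
      (ae_of_all _ fun τ _ => norm_pairing_le le_rfl (norm_deriv_le_of_lipschitz (hh i)))
      (i3.mul_const _)).trans ?_
    rw [intervalIntegral.integral_mul_const]
    exact mul_le_mul_of_nonneg_right hφ1 C.coe_nonneg
  have b' : ε / 2 / (C + 1) * C ≤ ε / 2 := by
    rw [div_mul_eq_mul_div, div_le_iff₀ (by positivity)]
    nlinarith [C.coe_nonneg]
  rw [dist_zero_right] at hi ⊢
  rw [e]
  refine (norm_add_le _ _).trans_lt ?_
  linarith

end Pairing

/-! ### Variation of the integral of `p dx` in a Lipschitz family of curves -/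

section TwoParameters

theorem LipschitzWith.uncurry_left {E : Type*} [NormedAddCommGroup E] {C : ℝ≥0} {x : ℝ → ℝ → E}
    (hx : LipschitzWith C (Function.uncurry x)) (s : ℝ) : LipschitzWith C (x s) :=
  LipschitzWith.of_dist_le_mul fun τ τ' => by
    simpa [Prod.dist_eq, Function.uncurry] using hx.dist_le_mul (s, τ) (s, τ')

theorem LipschitzWith.uncurry_right {E : Type*} [NormedAddCommGroup E] {C : ℝ≥0} {x : ℝ → ℝ → E}
    (hx : LipschitzWith C (Function.uncurry x)) (τ : ℝ) : LipschitzWith C (fun s => x s τ) :=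
  LipschitzWith.of_dist_le_mul fun s s' => by
    simpa [Prod.dist_eq, Function.uncurry] using hx.dist_le_mul (s, τ) (s', τ)

theorem continuous_uncurry_flip {E : Type*} [NormedAddCommGroup E] {x : ℝ → ℝ → E}
    (hx : Continuous (Function.uncurry x)) :
    Continuous (Function.uncurry fun τ s => x s τ) := hx.comp continuous_swap

variable {F : Type*} [NormedAddCommGroup F] [NormedSpace ℝ F] [FiniteDimensional ℝ F]

/-- The integral of the one-form `p dx` along the curve `τ ↦ (x s τ, p s τ)`, `0 ≤ τ ≤ 1`. -/
def actionIntegral (x : ℝ → ℝ → F) (p : ℝ → ℝ → F →L[ℝ] ℝ) (s : ℝ) : ℝ :=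
  ∫ τ in (0 : ℝ)..1, p s τ (deriv (x s) τ)

variable {x : ℝ → ℝ → F} {p : ℝ → ℝ → F →L[ℝ] ℝ} {C : ℝ≥0}

/-- Split `p' dx' - p dx = (p' - p) dx' + p d(x' - x)` and integrate the last term by parts. No
`τ`-derivative is then applied to the variation of `x`, whose limit, the `s`-derivative, need not be
differentiable in `τ`. -/
theorem actionIntegral_sub (hx : LipschitzWith C (Function.uncurry x))
    (hp : LipschitzWith C (Function.uncurry p)) (s s' : ℝ) :
    actionIntegral x p s' - actionIntegral x p s =
      (∫ τ in (0 : ℝ)..1, (p s' τ - p s τ) (deriv (x s') τ)) +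
      (p s 1 (x s' 1 - x s 1) - p s 0 (x s' 0 - x s 0) -
        ∫ τ in (0 : ℝ)..1, deriv (p s) τ (x s' τ - x s τ)) := by
  have h1 := integral_pairing_deriv_eq (hp.uncurry_left s)
    ((hx.uncurry_left s').sub (hx.uncurry_left s)) zero_le_one
  have i1 := (hx.uncurry_left s').intervalIntegrable_pairing_deriv
    (hp.uncurry_left s').continuous 0 1
  have i2 := (hx.uncurry_left s').intervalIntegrable_pairing_deriv
    (hp.uncurry_left s).continuous 0 1
  have i3 := (hx.uncurry_left s).intervalIntegrable_pairing_deriv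
    (hp.uncurry_left s).continuous 0 1
  have h2 : ∫ τ in (0 : ℝ)..1, p s τ (deriv (fun τ => x s' τ - x s τ) τ) =
      ∫ τ in (0 : ℝ)..1, (p s τ (deriv (x s') τ) - p s τ (deriv (x s) τ)) := by
    refine intervalIntegral.integral_congr_ae ?_
    filter_upwards [(hx.uncurry_left s').ae_differentiableAt_real,
      (hx.uncurry_left s).ae_differentiableAt_real] with τ a b _
    rw [deriv_fun_sub a b, map_sub]
  rw [← h1, h2, intervalIntegral.integral_sub i2 i3]
  simp only [sub_apply]
  rw [intervalIntegral.integral_sub i1 i2]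
  simp [actionIntegral]

theorem norm_sub_le_of_lipschitz_uncurry {E : Type*} [NormedAddCommGroup E] {x : ℝ → ℝ → E}
    (hx : LipschitzWith C (Function.uncurry x)) (s s' τ : ℝ) :
    ‖x s' τ - x s τ‖ ≤ C * |s' - s| := (hx.uncurry_right τ).norm_sub_le s' s

/-- This supplies the finite Dini derivates in `s` needed to recover the action integral from its
almost everywhere derivative. -/
theorem exists_norm_actionIntegral_sub_le (hx : LipschitzWith C (Function.uncurry x))
    (hp : LipschitzWith C (Function.uncurry p)) (a b : ℝ) :
    ∃ A : ℝ, ∀ s ∈ Icc a b, ∀ s', ‖actionIntegral x p s' - actionIntegral x p s‖ ≤ A * |s' - s| := by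
  obtain ⟨P, hP⟩ := (isCompact_Icc (a := a) (b := b)).prod (isCompact_Icc (a := (0 : ℝ)) (b := 1))
    |>.exists_bound_of_continuousOn hp.continuous.continuousOn
  have hP' : ∀ s ∈ Icc a b, ∀ τ ∈ Icc (0 : ℝ) 1, ‖p s τ‖ ≤ P := fun s hs τ hτ => hP (s, τ) ⟨hs, hτ⟩
  refine ⟨C * C + (P * C + P * C + C * C), fun s hs s' => ?_⟩
  rw [actionIntegral_sub hx hp]
  have b1 : ‖∫ τ in (0 : ℝ)..1, (p s' τ - p s τ) (deriv (x s') τ)‖ ≤ (C * |s' - s|) * C := by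
    simpa using intervalIntegral.norm_integral_le_of_norm_le_const (a := (0 : ℝ)) (b := 1)
      fun τ _ => norm_pairing_le (norm_sub_le_of_lipschitz_uncurry hp s s' τ)
        (norm_deriv_le_of_lipschitz (hx.uncurry_left s') (x₀ := τ))
  have b2 : ‖∫ τ in (0 : ℝ)..1, deriv (p s) τ (x s' τ - x s τ)‖ ≤ C * (C * |s' - s|) := by
    simpa using intervalIntegral.norm_integral_le_of_norm_le_const (a := (0 : ℝ)) (b := 1)
      fun τ _ => norm_pairing_le (norm_deriv_le_of_lipschitz (hp.uncurry_left s) (x₀ := τ))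
        (norm_sub_le_of_lipschitz_uncurry hx s s' τ)
  have b3 := norm_pairing_le (hP' s hs 1 (by simp)) (norm_sub_le_of_lipschitz_uncurry hx s s' 1)
  have b4 := norm_pairing_le (hP' s hs 0 (by simp)) (norm_sub_le_of_lipschitz_uncurry hx s s' 0)
  refine (norm_add_le _ _).trans ((add_le_add b1 ((norm_sub_le _ _).trans
    (add_le_add ((norm_sub_le _ _).trans (add_le_add b3 b4)) b2))).trans (le_of_eq ?_))
  ring

set_option maxHeartbeats 400000 in
/-- The derivative in `s` of the integral of `p dx` (Cartan's formula for Lipschitz maps). -/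
theorem hasDerivAt_actionIntegral (hx : LipschitzWith C (Function.uncurry x))
    (hp : LipschitzWith C (Function.uncurry p)) {s : ℝ}
    (h0 : DifferentiableAt ℝ (fun s => x s 0) s) (h1 : DifferentiableAt ℝ (fun s => x s 1) s)
    (hxd : ∀ᵐ τ : ℝ, DifferentiableAt ℝ (fun s => x s τ) s)
    (hpd : ∀ᵐ τ : ℝ, DifferentiableAt ℝ (fun s => p s τ) s) :
    HasDerivAt (actionIntegral x p)
      (p s 1 (deriv (fun s => x s 1) s) - p s 0 (deriv (fun s => x s 0) s) -
        ∫ τ in (0 : ℝ)..1, (deriv (p s) τ (deriv (fun s => x s τ) s) -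
          deriv (fun s => p s τ) s (deriv (x s) τ))) s := by
  rw [hasDerivAt_iff_tendsto_slope_zero]
  have mp : AEStronglyMeasurable (fun τ => deriv (fun s => p s τ) s) volume :=
    (stronglyMeasurable_deriv_with_param (continuous_uncurry_flip hp.continuous)
      |>.comp_measurable measurable_prodMk_right).aestronglyMeasurable
  have mx : AEStronglyMeasurable (fun τ => deriv (fun s => x s τ) s) volume :=
    (stronglyMeasurable_deriv_with_param (continuous_uncurry_flip hx.continuous)
      |>.comp_measurable measurable_prodMk_right).aestronglyMeasurable
  have bp : ∀ τ, ‖deriv (fun s => p s τ) s‖ ≤ C := fun τ =>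
    norm_deriv_le_of_lipschitz (hp.uncurry_right τ)
  have bx : ∀ τ, ‖deriv (fun s => x s τ) s‖ ≤ C := fun τ =>
    norm_deriv_le_of_lipschitz (hx.uncurry_right τ)
  have lim : ∀ {E : Type _} [NormedAddCommGroup E] [NormedSpace ℝ E] {f : ℝ → E},
      DifferentiableAt ℝ f s → Tendsto (fun t => t⁻¹ • (f (s + t) - f s)) (𝓝[≠] 0)
        (𝓝 (deriv f s)) := fun h => hasDerivAt_iff_tendsto_slope_zero.1 h.hasDerivAt
  have bd : ∀ {E : Type _} [NormedAddCommGroup E] [NormedSpace ℝ E] {y : ℝ → ℝ → E},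
      LipschitzWith C (Function.uncurry y) →
      ∀ t τ, ‖t⁻¹ • (y (s + t) τ - y s τ)‖ ≤ C := by
    intro E _ _ y hy t τ
    rw [norm_smul, norm_inv, Real.norm_eq_abs]
    have := norm_sub_le_of_lipschitz_uncurry hy s (s + t) τ
    rw [add_sub_cancel_left] at this
    rcases eq_or_ne t 0 with rfl | ht
    · simp
    · rw [inv_mul_le_iff₀ (abs_pos.2 ht), mul_comm]
      exact this
  have mq : ∀ t : ℝ, AEStronglyMeasurable (fun τ => t⁻¹ • (p (s + t) τ - p s τ)) volume :=
    fun t => (((hp.uncurry_left (s + t)).continuous.sub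
      (hp.uncurry_left s).continuous).aestronglyMeasurable).const_smul t⁻¹
  have my : ∀ t : ℝ, AEStronglyMeasurable (fun τ => t⁻¹ • (x (s + t) τ - x s τ)) volume :=
    fun t => (((hx.uncurry_left (s + t)).continuous.sub
      (hx.uncurry_left s).continuous).aestronglyMeasurable).const_smul t⁻¹
  have bq : ∀ t τ : ℝ, ‖t⁻¹ • (p (s + t) τ - p s τ) - deriv (fun s => p s τ) s‖ ≤ C + C :=
    fun t τ => (norm_sub_le _ _).trans (add_le_add (bd hp t τ) (bp τ))
  have mr : ∀ t : ℝ, AEStronglyMeasurable (fun τ => (t⁻¹ • (p (s + t) τ - p s τ) -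
        deriv (fun s => p s τ) s) (deriv (x (s + t)) τ)) volume := fun t =>
    aestronglyMeasurable_pairing ((mq t).sub mp) (aestronglyMeasurable_deriv _ _)
  have br : ∀ t τ : ℝ, ‖(t⁻¹ • (p (s + t) τ - p s τ) -
        deriv (fun s => p s τ) s) (deriv (x (s + t)) τ)‖ ≤ (C + C) * C := fun t τ =>
    norm_pairing_le (bq t τ) (norm_deriv_le_of_lipschitz (hx.uncurry_left (s + t)))
  -- The difference quotients of `p` converge almost everywhere, while the velocity of `x (s + t)`
  -- stays bounded.
  have T1 : Tendsto (fun t => ∫ τ in (0 : ℝ)..1,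
      (t⁻¹ • (p (s + t) τ - p s τ) - deriv (fun s => p s τ) s) (deriv (x (s + t)) τ))
      (𝓝[≠] 0) (𝓝 0) := by
    have : Tendsto (fun t => ∫ τ in (0 : ℝ)..1,
      (t⁻¹ • (p (s + t) τ - p s τ) - deriv (fun s => p s τ) s) (deriv (x (s + t)) τ))
      (𝓝[≠] 0) (𝓝 (∫ τ in (0 : ℝ)..1, (0 : ℝ))) := by
      refine intervalIntegral.tendsto_integral_filter_of_dominated_convergence
        (fun _ => (C + C) * C) ?_ ?_ intervalIntegrable_const ?_
      · exact Eventually.of_forall fun t => (mr t).restrict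
      · exact Eventually.of_forall fun t => ae_of_all _ fun τ _ => br t τ
      · filter_upwards [hpd] with τ hτ _
        have h := (lim hτ).sub_const (deriv (fun s => p s τ) s)
        rw [sub_self] at h
        refine squeeze_zero_norm (a := fun t =>
          ‖t⁻¹ • (p (s + t) τ - p s τ) - deriv (fun s => p s τ) s‖ * C) (fun t =>
          norm_pairing_le le_rfl (norm_deriv_le_of_lipschitz (hx.uncurry_left (s + t)))) ?_
        simpa using h.norm.mul_const (C : ℝ)
    simpa using this
  -- The velocities of `x (s + t)` need not converge pointwise to that of `x s`. They converge
  -- weakly, which suffices against the fixed bounded function `∂ₛp`.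
  have T2 : Tendsto (fun t => ∫ τ in (0 : ℝ)..1,
      deriv (fun s => p s τ) s (deriv (fun τ => x (s + t) τ - x s τ) τ)) (𝓝[≠] 0) (𝓝 0) := by
    refine tendsto_integral_pairing_deriv_zero (C := C + C)
      (fun t => (hx.uncurry_left _).sub (hx.uncurry_left _)) (fun τ => ?_) mp bp
    have : Tendsto (fun t => x (s + t) τ - x s τ) (𝓝 0) (𝓝 (x (s + 0) τ - x s τ)) := by
      refine Tendsto.sub_const ?_ _
      exact ((hx.uncurry_right τ).continuous.comp (continuous_const.add continuous_id)).tendsto 0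
    simpa using this.mono_left nhdsWithin_le_nhds
  have T3 : Tendsto (fun t => ∫ τ in (0 : ℝ)..1, deriv (p s) τ (t⁻¹ • (x (s + t) τ - x s τ)))
      (𝓝[≠] 0) (𝓝 (∫ τ in (0 : ℝ)..1, deriv (p s) τ (deriv (fun s => x s τ) s))) := by
    refine intervalIntegral.tendsto_integral_filter_of_dominated_convergence
      (fun _ => C * C) ?_ ?_ intervalIntegrable_const ?_
    · exact Eventually.of_forall fun t => (aestronglyMeasurable_pairing
        (aestronglyMeasurable_deriv _ _) (my t)).restrict
    · refine Eventually.of_forall fun t => ae_of_all _ fun τ _ => ?_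
      exact norm_pairing_le (norm_deriv_le_of_lipschitz (hp.uncurry_left s)) (bd hx t τ)
    · filter_upwards [hxd] with τ hτ _
      exact ((deriv (p s) τ).continuous.tendsto _).comp (lim hτ)
  -- The boundary terms require differentiability exactly at `τ = 0` and `τ = 1`, which an almost
  -- everywhere statement in `τ` does not provide.
  have T4 := ((p s 1).continuous.tendsto _).comp (lim h1)
  have T5 := ((p s 0).continuous.tendsto _).comp (lim h0)
  have i0 : IntervalIntegrable (fun τ => deriv (fun s => p s τ) s (deriv (x s) τ)) volume 0 1 :=
    intervalIntegrable_of_bounded (aestronglyMeasurable_pairing mp (aestronglyMeasurable_deriv _ _))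
      fun τ _ => norm_pairing_le (bp τ) (norm_deriv_le_of_lipschitz (hx.uncurry_left s))
  have i5 : IntervalIntegrable (fun τ => deriv (p s) τ (deriv (fun s => x s τ) s)) volume 0 1 :=
    intervalIntegrable_of_bounded (aestronglyMeasurable_pairing (aestronglyMeasurable_deriv _ _) mx)
      fun τ _ => norm_pairing_le (norm_deriv_le_of_lipschitz (hp.uncurry_left s)) (bx τ)
  have T := ((T1.add T2).add_const (∫ τ in (0 : ℝ)..1,
    deriv (fun s => p s τ) s (deriv (x s) τ))).add ((T4.sub T5).sub T3)
  convert T using 1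
  · ext t
    rw [actionIntegral_sub hx hp, smul_add, smul_sub, smul_sub]
    have i1 : IntervalIntegrable (fun τ => (t⁻¹ • (p (s + t) τ - p s τ) -
        deriv (fun s => p s τ) s) (deriv (x (s + t)) τ)) volume 0 1 :=
      intervalIntegrable_of_bounded (mr t) fun τ _ => br t τ
    have i2 : IntervalIntegrable (fun τ => deriv (fun s => p s τ) s
        (deriv (fun τ => x (s + t) τ - x s τ) τ)) volume 0 1 :=
      intervalIntegrable_of_bounded
        (aestronglyMeasurable_pairing mp (aestronglyMeasurable_deriv _ _))
        fun τ _ => norm_pairing_le (bp τ) (norm_deriv_le_of_lipschitz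
          ((hx.uncurry_left (s + t)).sub (hx.uncurry_left s)))
    have e : t⁻¹ • (∫ τ in (0 : ℝ)..1, (p (s + t) τ - p s τ) (deriv (x (s + t)) τ)) =
        (∫ τ in (0 : ℝ)..1, (t⁻¹ • (p (s + t) τ - p s τ) -
          deriv (fun s => p s τ) s) (deriv (x (s + t)) τ)) +
        (∫ τ in (0 : ℝ)..1, deriv (fun s => p s τ) s
          (deriv (fun τ => x (s + t) τ - x s τ) τ)) +
        ∫ τ in (0 : ℝ)..1, deriv (fun s => p s τ) s (deriv (x s) τ) := by
      rw [← intervalIntegral.integral_add i1 i2, ← intervalIntegral.integral_add (i1.add i2) i0,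
        ← intervalIntegral.integral_smul]
      refine intervalIntegral.integral_congr_ae ?_
      filter_upwards [(hx.uncurry_left (s + t)).ae_differentiableAt_real,
        (hx.uncurry_left s).ae_differentiableAt_real] with τ a b _
      rw [deriv_fun_sub a b]
      simp
    rw [e, ← intervalIntegral.integral_smul]
    simp
  · rw [intervalIntegral.integral_sub i5 i0]
    congr 1
    ring

end TwoParameters

/-! ### Measurability, Fubini, and Cartan's formula for a family of curves -/

section Caratheodory

/-- A function that is continuous in the second variable for almost every value of the first one
and almost everywhere measurable in the first one has a jointly measurable version. -/
theorem exists_measurable_uncurry_of_ae_continuous {μ : Measure ℝ} {K : ℝ → ℝ → ℝ}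
    (hc : ∀ᵐ s ∂μ, Continuous (K s)) (hm : ∀ τ, AEMeasurable (fun s => K s τ) μ) :
    ∃ K' : ℝ → ℝ → ℝ, Measurable (Function.uncurry K') ∧ (∀ s, Continuous (K' s)) ∧
      ∀ᵐ s ∂μ, K' s = K s := by
  classical
  have hall : ∀ᵐ s ∂μ, Continuous (K s) ∧ ∀ q : ℚ, K s q = (hm q).mk _ s :=
    hc.and (ae_all_iff.2 fun q => (hm q).ae_eq_mk)
  obtain ⟨A, hA, hAm, hA0⟩ := hall.exists_measurable_mem
  -- On a measurable conull set of `s` all rational slices agree with measurable versions.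
  -- Continuity in `τ` carries measurability over to the other slices.
  let K' : ℝ → ℝ → ℝ := fun s τ => if s ∈ A then K s τ else 0
  have hK'c : ∀ s, Continuous (K' s) := by
    intro s
    by_cases hs : s ∈ A
    · simpa [K', hs] using (hA0 s hs).1
    · simpa [K', hs] using continuous_const
  have hK'q : ∀ q : ℚ, Measurable fun s => K' s q := by
    intro q
    have : (fun s => K' s q) = fun s => if s ∈ A then (hm q).mk _ s else 0 := by
      ext s
      by_cases hs : s ∈ A
      · simpa [K', hs] using (hA0 s hs).2 q
      · simp [K', hs]
    rw [this]
    exact Measurable.ite hAm (hm q).measurable_mk measurable_const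
  have hK'm : ∀ τ, Measurable fun s => K' s τ := by
    intro τ
    have : ∃ r : ℕ → ℚ, Tendsto (fun n => (r n : ℝ)) atTop (𝓝 τ) := by
      have hd : τ ∈ closure (range ((↑) : ℚ → ℝ)) := Rat.denseRange_cast τ
      obtain ⟨v, hv, hvt⟩ := mem_closure_iff_seq_limit.1 hd
      choose r hr using hv
      exact ⟨r, by simpa [hr] using hvt⟩
    obtain ⟨r, hr⟩ := this
    exact measurable_of_tendsto_metrizable (fun n => hK'q (r n))
      (tendsto_pi_nhds.2 fun s => ((hK'c s).tendsto τ).comp hr)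
  refine ⟨K', ?_, hK'c, ?_⟩
  · have := measurable_uncurry_of_continuous_of_measurable (u := fun τ s => K' s τ)
      (fun s => hK'c s) hK'm
    exact this.comp measurable_swap
  · filter_upwards [hA] with s hs
    ext τ
    simp [K', hs]

/-- By continuity the estimate for rational increments extends to real ones. With countable
quantifiers only, the condition is visibly measurable in parameters. -/
theorem hasDerivAt_iff_forall_rat {f : ℝ → ℝ} (hf : Continuous f) {a τ : ℝ} :
    HasDerivAt f a τ ↔ ∀ m : ℕ, ∃ n : ℕ, ∀ q : ℚ, |(q : ℝ)| < 1 / (n + 1) →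
      |f (τ + q) - f τ - q * a| ≤ 1 / (m + 1) * |(q : ℝ)| := by
  rw [hasDerivAt_iff_isLittleO_nhds_zero, Asymptotics.isLittleO_iff]
  constructor
  · intro h m
    obtain ⟨ε, hε, hb⟩ := Metric.eventually_nhds_iff.1 (h (c := 1 / (m + 1)) (by positivity))
    obtain ⟨n, hn⟩ := exists_nat_one_div_lt hε
    refine ⟨n, fun q hq => ?_⟩
    have := hb (y := (q : ℝ)) (by rw [Real.dist_eq, sub_zero]; exact hq.trans hn)
    rwa [Real.norm_eq_abs, Real.norm_eq_abs, smul_eq_mul] at this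
  · intro h c hc
    obtain ⟨m, hm⟩ := exists_nat_one_div_lt hc
    obtain ⟨n, hn⟩ := h m
    have hpos : (0 : ℝ) < 1 / (n + 1) := by positivity
    have key : ∀ t : ℝ, |t| < 1 / (n + 1) → |f (τ + t) - f τ - t * a| ≤ 1 / (m + 1) * |t| := by
      intro t ht
      have hU : IsOpen {t : ℝ | |t| < 1 / (n + 1)} := isOpen_lt continuous_abs continuous_const
      have hcl : t ∈ closure ({t : ℝ | |t| < 1 / (n + 1)} ∩ range ((↑) : ℚ → ℝ)) :=
        (Rat.denseRange_cast (𝕜 := ℝ)).open_subset_closure_inter hU ht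
      have hclosed : IsClosed {t : ℝ | |f (τ + t) - f τ - t * a| ≤ 1 / (m + 1) * |t|} :=
        isClosed_le (by fun_prop) (by fun_prop)
      refine closure_minimal ?_ hclosed hcl
      rintro _ ⟨h1, q, rfl⟩
      exact hn q h1
    filter_upwards [Metric.ball_mem_nhds (0 : ℝ) hpos] with t ht
    have h1 := key t (by simpa using ht)
    have h2 : 1 / ((m : ℝ) + 1) * |t| ≤ c * |t| := mul_le_mul_of_nonneg_right hm.le (abs_nonneg t)
    simpa using h1.trans h2

/-- Needed to exchange "almost every `s`" and "almost every `τ`" when `K` is continuous in `τ` but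
merely measurable in `s`. -/
theorem measurableSet_hasDerivAt_uncurry {K u : ℝ → ℝ → ℝ} (hK : Measurable (Function.uncurry K))
    (hc : ∀ s, Continuous (K s)) (hu : Measurable (Function.uncurry u)) :
    MeasurableSet {z : ℝ × ℝ | HasDerivAt (K z.1) (u z.1 z.2) z.2} := by
  have e : {z : ℝ × ℝ | HasDerivAt (K z.1) (u z.1 z.2) z.2} =
      ⋂ m : ℕ, ⋃ n : ℕ, ⋂ q : ℚ, ⋂ _ : |(q : ℝ)| < 1 / (n + 1),
        {z : ℝ × ℝ | |K z.1 (z.2 + q) - K z.1 z.2 - q * u z.1 z.2| ≤ 1 / (m + 1) * |(q : ℝ)|} := by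
    ext z
    simp only [mem_ofPred_eq, mem_iInter, mem_iUnion]
    exact hasDerivAt_iff_forall_rat (hc z.1)
  rw [e]
  refine MeasurableSet.iInter fun m => MeasurableSet.iUnion fun n => MeasurableSet.iInter fun q =>
    MeasurableSet.iInter fun _ => measurableSet_le ?_ measurable_const
  have h1 : Measurable fun z : ℝ × ℝ => K z.1 (z.2 + q) :=
    hK.comp (measurable_fst.prodMk (measurable_snd.add_const _))
  have h2 : Measurable fun z : ℝ × ℝ => K z.1 z.2 := hK
  have h3 : Measurable fun z : ℝ × ℝ => u z.1 z.2 := hu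
  exact ((h1.sub h2).sub (h3.const_mul _)).abs

variable {F : Type*} [NormedAddCommGroup F] [NormedSpace ℝ F] [FiniteDimensional ℝ F]
  {x : ℝ → ℝ → F} {p : ℝ → ℝ → F →L[ℝ] ℝ} {C : ℝ≥0}

/-- The action integral along a Lipschitz family of curves of solutions of Hamilton's equations
changes by the integral of `p dx - K ds`. The energy `K` only has to be continuous with finite Dini
derivates in `τ` for almost every `s`, and to satisfy `dK = dp (∂ₛx) - (∂ₛp) dx` in `τ` for every
`τ` and almost every `s`. -/
theorem integral_sub_eq_actionIntegral_sub (hx : LipschitzWith C (Function.uncurry x))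
    (hp : LipschitzWith C (Function.uncurry p)) {a b : ℝ} (hab : a ≤ b) {K g : ℝ → ℝ → ℝ}
    (hKc : ∀ᵐ s ∂(volume.restrict (Icc a b)), Continuous (K s))
    (hKO : ∀ᵐ s ∂(volume.restrict (Icc a b)), ∀ τ,
      (fun τ' => K s τ' - K s τ) =O[𝓝 τ] fun τ' => τ' - τ)
    (hKo : ∀ τ, ∀ᵐ s ∂(volume.restrict (Icc a b)),
      (fun τ' => K s τ' - K s τ - ((p s τ' - p s τ) (deriv (fun s => x s τ) s) -
        deriv (fun s => p s τ) s (x s τ' - x s τ))) =o[𝓝 τ] fun τ' => τ' - τ)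
    (hg : ∀ τ, ∀ᵐ s ∂(volume.restrict (Icc a b)),
      g s τ = p s τ (deriv (fun s => x s τ) s) - K s τ)
    (hgi : ∀ τ, IntegrableOn (fun s => g s τ) (Icc a b)) :
    ∫ s in a..b, (g s 1 - g s 0) = actionIntegral x p b - actionIntegral x p a := by
  set μ := volume.restrict (Icc a b) with hμ
  -- Up to sign, the coefficient of the pullback of `dp ∧ dx` to the `(s, τ)`-plane; Hamilton's
  -- equations make it the `τ`-derivative of the energy.
  let u : ℝ → ℝ → ℝ := fun s τ => deriv (p s) τ (deriv (fun s => x s τ) s) -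
    deriv (fun s => p s τ) s (deriv (x s) τ)
  have mp2 : StronglyMeasurable fun z : ℝ × ℝ => deriv (p z.1) z.2 :=
    stronglyMeasurable_deriv_with_param hp.continuous
  have mx2 : StronglyMeasurable fun z : ℝ × ℝ => deriv (x z.1) z.2 :=
    stronglyMeasurable_deriv_with_param hx.continuous
  have mp1 : StronglyMeasurable fun z : ℝ × ℝ => deriv (fun s => p s z.2) z.1 :=
    (stronglyMeasurable_deriv_with_param (continuous_uncurry_flip hp.continuous)).comp_measurable
      measurable_swap
  have mx1 : StronglyMeasurable fun z : ℝ × ℝ => deriv (fun s => x s z.2) z.1 :=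
    (stronglyMeasurable_deriv_with_param (continuous_uncurry_flip hx.continuous)).comp_measurable
      measurable_swap
  have bil : Continuous fun w : (F →L[ℝ] ℝ) × F => w.1 w.2 :=
    isBoundedBilinearMap_apply.continuous
  have hu : Measurable (Function.uncurry u) :=
    ((bil.comp_stronglyMeasurable (mp2.prodMk mx1)).sub
      (bil.comp_stronglyMeasurable (mp1.prodMk mx2))).measurable
  have ub : ∀ s τ, ‖u s τ‖ ≤ C * C + C * C := fun s τ =>
    (norm_sub_le _ _).trans (add_le_add
      (norm_pairing_le (norm_deriv_le_of_lipschitz (hp.uncurry_left s))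
        (norm_deriv_le_of_lipschitz (hx.uncurry_right τ)))
      (norm_pairing_le (norm_deriv_le_of_lipschitz (hp.uncurry_right τ))
        (norm_deriv_le_of_lipschitz (hx.uncurry_left s))))
  -- The energy is not assumed measurable in time; it is recovered from the measurable functions `g`
  -- and `p(∂ₛx)`.
  have hKm : ∀ τ, AEMeasurable (fun s => K s τ) μ := by
    intro τ
    have h1 : AEMeasurable (fun s => p s τ (deriv (fun s => x s τ) s) - g s τ) μ :=
      ((aestronglyMeasurable_pairing (hp.uncurry_right τ).continuous.aestronglyMeasurable
        (aestronglyMeasurable_deriv _ _)).sub (hgi τ).aestronglyMeasurable).aemeasurable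
    refine h1.congr ?_
    filter_upwards [hg τ] with s hs
    rw [hs]
    ring
  obtain ⟨K', hK'm, hK'c, hK'⟩ := exists_measurable_uncurry_of_ae_continuous hKc hKm
  have hdiff : ∀ᵐ τ : ℝ, ∀ᵐ s ∂μ, DifferentiableAt ℝ (x s) τ ∧ DifferentiableAt ℝ (p s) τ := by
    have hm : MeasurableSet {z : ℝ × ℝ | DifferentiableAt ℝ (x z.1) z.2 ∧
        DifferentiableAt ℝ (p z.1) z.2} :=
      (measurableSet_of_differentiableAt_with_param ℝ hx.continuous).inter
        (measurableSet_of_differentiableAt_with_param ℝ hp.continuous)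
    rw [← Measure.ae_ae_comm (p := fun s τ => DifferentiableAt ℝ (x s) τ ∧
      DifferentiableAt ℝ (p s) τ) hm]
    exact ae_of_all _ fun s => (hx.uncurry_left s).ae_differentiableAt_real.and
      (hp.uncurry_left s).ae_differentiableAt_real
  -- The expansion `hKo` holds outside a set of times depending on `τ`. Fubini, applied to the
  -- measurable version `K'`, gives for almost every fixed time the derivative in almost every `τ`.
  have hder : ∀ᵐ s ∂μ, ∀ᵐ τ : ℝ, HasDerivAt (K' s) (u s τ) τ := by
    rw [Measure.ae_ae_comm (p := fun s τ => HasDerivAt (K' s) (u s τ) τ)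
      (measurableSet_hasDerivAt_uncurry hK'm hK'c hu)]
    filter_upwards [hdiff] with τ hτ
    filter_upwards [hτ, hKo τ, hK'] with s hs ho hs'
    rw [hs', hasDerivAt_iff_isLittleO]
    have hx1 := hasDerivAt_iff_isLittleO.1 hs.1.hasDerivAt
    have hp1 := hasDerivAt_iff_isLittleO.1 hs.2.hasDerivAt
    have e1 : (fun τ' => (p s τ' - p s τ - (τ' - τ) • deriv (p s) τ)
        (deriv (fun s => x s τ) s)) =o[𝓝 τ] fun τ' => τ' - τ :=
      ((ContinuousLinearMap.apply ℝ ℝ (deriv (fun s => x s τ) s)).isBigO_comp _ _).trans_isLittleO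
        hp1
    have e2 : (fun τ' => deriv (fun s => p s τ) s (x s τ' - x s τ - (τ' - τ) • deriv (x s) τ))
        =o[𝓝 τ] fun τ' => τ' - τ :=
      ((deriv (fun s => p s τ) s).isBigO_comp _ _).trans_isLittleO hx1
    refine ((ho.add e1).sub e2).congr_left fun τ' => ?_
    simp only [u, sub_apply, smul_apply, map_sub, map_smul, smul_eq_mul]
    ring
  have hxd : ∀ᵐ s ∂μ, ∀ᵐ τ : ℝ, DifferentiableAt ℝ (fun s => x s τ) s ∧
      DifferentiableAt ℝ (fun s => p s τ) s := by
    have hm : MeasurableSet {z : ℝ × ℝ | DifferentiableAt ℝ (fun s => x s z.1) z.2 ∧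
        DifferentiableAt ℝ (fun s => p s z.1) z.2} :=
      (measurableSet_of_differentiableAt_with_param (f := fun τ s => x s τ) ℝ
        (continuous_uncurry_flip hx.continuous)).inter
        (measurableSet_of_differentiableAt_with_param (f := fun τ s => p s τ) ℝ
        (continuous_uncurry_flip hp.continuous))
    rw [← Measure.ae_ae_comm (p := fun τ s => DifferentiableAt ℝ (fun s => x s τ) s ∧
      DifferentiableAt ℝ (fun s => p s τ) s) hm]
    exact ae_of_all _ fun τ => ae_restrict_of_ae
      ((hx.uncurry_right τ).ae_differentiableAt_real.and
        (hp.uncurry_right τ).ae_differentiableAt_real)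
  obtain ⟨A, hA⟩ := exists_norm_actionIntegral_sub_le hx hp a b
  have hAO : ∀ s ∈ Icc a b, (fun s' => actionIntegral x p s' - actionIntegral x p s) =O[𝓝 s]
      fun s' => s' - s := fun s hs =>
    Asymptotics.IsBigO.of_bound A (Eventually.of_forall fun s' => hA s hs s')
  refine integral_eq_sub_of_isBigO_of_ae_hasDerivAt hab (fun s hs => ?_)
    (fun s hs => (hAO s (Ico_subset_Icc_self hs)).mono nhdsWithin_le_nhds)
    ((hgi 1).sub (hgi 0)) ?_
  · have h0 : Tendsto (fun s' => s' - s) (𝓝 s) (𝓝 0) := by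
      simpa using (continuous_id.sub continuous_const).tendsto (f := fun s' : ℝ => s' - s) s
    have := (hAO s hs).trans_tendsto h0
    exact (tendsto_sub_nhds_zero_iff.1 this).mono_left nhdsWithin_le_nhds
  · filter_upwards [hder, hxd, hK', hKO, hg 1, hg 0,
      ae_restrict_of_ae (hx.uncurry_right 0).ae_differentiableAt_real,
      ae_restrict_of_ae (hx.uncurry_right 1).ae_differentiableAt_real] with
      s hder hxd hs' hO hg1 hg0 hx0 hx1
    have hD := hasDerivAt_actionIntegral hx hp hx0 hx1 (hxd.mono fun _ h => h.1)
      (hxd.mono fun _ h => h.2)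
    have hi : IntegrableOn (u s) (Icc 0 1) :=
      (intervalIntegrable_iff_integrableOn_Icc_of_le zero_le_one).1
        (intervalIntegrable_of_bounded
          (hu.comp measurable_prodMk_left).aestronglyMeasurable fun τ _ => ub s τ)
    -- The curvature term of the variation formula integrates to the energy increment. What remains
    -- of the derivative of the action is the boundary value of `p(∂ₛx) - K`, that is, of `g`.
    have hI := integral_eq_sub_of_isBigO_of_ae_hasDerivAt (g := K' s) (g' := u s) zero_le_one
      (hK'c s).continuousOn
      (fun τ _ => by rw [hs']; exact (hO τ).mono nhdsWithin_le_nhds) hi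
      (ae_restrict_of_ae (hder.mono fun τ h => h.hasDerivWithinAt))
    rw [hs'] at hI
    rw [show (∫ τ in (0 : ℝ)..1, (deriv (p s) τ (deriv (fun s => x s τ) s) -
      deriv (fun s => p s τ) s (deriv (x s) τ))) = K s 1 - K s 0 from hI] at hD
    refine (hD.congr_deriv ?_).hasDerivWithinAt
    rw [hg1, hg0]
    ring

end Caratheodory

/-! ### Uniqueness of differentials on bi-Lipschitz images -/

section UniqueDiff

variable {E : Type*} [NormedAddCommGroup E] [NormedSpace ℝ E] [FiniteDimensional ℝ E]

/-- Expanding maps of the unit ball do not send it into thin neighbourhoods of a hyperplane. -/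
theorem exists_slab_width (e : E →L[ℝ] ℝ) (he : e ≠ 0) (A : ℝ≥0) (L : ℝ) :
    ∃ ε > 0, ∀ f : E → E,
      (∀ u ∈ Metric.ball (0 : E) 1, ∀ v ∈ Metric.ball (0 : E) 1, dist u v ≤ A * dist (f u) (f v)) →
      (∀ u ∈ Metric.ball (0 : E) 1, ‖f u‖ ≤ L) → ∃ u ∈ Metric.ball (0 : E) 1, ε < |e (f u)| := by
  classical
  borelize E
  set d := Module.finrank ℝ E
  -- Hausdorff measure in the full dimension is a Haar measure, and it is multiplied by at most `A ^
  -- d` under `A`-Lipschitz maps.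
  let μ : Measure E := Measure.hausdorffMeasure d
  have : μ.IsAddHaarMeasure := isAddHaarMeasure_hausdorffMeasure
  -- Slabs decreasing to a bounded piece of a hyperplane, so their measures tend to zero.
  let T : ℕ → Set E := fun k => Metric.closedBall 0 L ∩ {y | |e y| ≤ 1 / ((k : ℝ) + 1)}
  have hTc : ∀ k, IsClosed (T k) := fun k =>
    Metric.isClosed_closedBall.inter (isClosed_le (by fun_prop) continuous_const)
  have hTa : Antitone T := fun k l hkl => inter_subset_inter_right _ fun y hy =>
    le_trans (show |e y| ≤ 1 / ((l : ℝ) + 1) from hy) (Nat.one_div_le_one_div hkl)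
  have hlim := tendsto_measure_iInter_atTop (μ := μ) (s := T)
    (fun k => (hTc k).measurableSet.nullMeasurableSet) hTa
    ⟨0, ((isCompact_closedBall (0 : E) L).inter_right
      (isClosed_le (by fun_prop) continuous_const)).measure_lt_top.ne⟩
  have h0 : μ (⋂ k, T k) = 0 := by
    refine measure_mono_null (t := ((LinearMap.ker e.toLinearMap : Submodule ℝ E) : Set E)) ?_
      (Measure.addHaar_submodule μ _ ?_)
    · intro y hy
      have h1 : ∀ k : ℕ, |e y| ≤ 1 / ((k : ℝ) + 1) := fun k => (mem_iInter.1 hy k).2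
      have h2 : |e y| ≤ 0 := ge_of_tendsto' tendsto_one_div_add_atTop_nhds_zero_nat h1
      exact abs_nonpos_iff.1 h2
    · intro h
      refine he (ContinuousLinearMap.ext fun y => ?_)
      have : y ∈ LinearMap.ker e.toLinearMap := h ▸ Submodule.mem_top
      exact this
  rw [h0] at hlim
  have hb : 0 < μ (Metric.ball (0 : E) 1) := Metric.measure_ball_pos _ _ one_pos
  have hlim2 : Tendsto (fun k => (A : ℝ≥0∞) ^ (d : ℝ) * μ (T k)) atTop (𝓝 0) := by
    have := ENNReal.Tendsto.const_mul hlim (a := (A : ℝ≥0∞) ^ (d : ℝ))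
      (Or.inr (ENNReal.rpow_ne_top_of_nonneg (Nat.cast_nonneg _) ENNReal.coe_ne_top))
    simpa using this
  obtain ⟨k, hk⟩ := (hlim2.eventually (gt_mem_nhds hb)).exists
  refine ⟨1 / ((k : ℝ) + 1), by positivity, fun f hf hfL => ?_⟩
  by_contra! hcon
  -- If the image lay in this slab, the inverse of `f` would map a subset of it onto the unit ball,
  -- although `A ^ d` times the measure of the slab is smaller than that of the ball.
  have himg : f '' Metric.ball 0 1 ⊆ T k := by
    rintro _ ⟨u, hu, rfl⟩
    exact ⟨by simpa using hfL u hu, hcon u hu⟩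
  have hinj : InjOn f (Metric.ball 0 1) := fun u hu v hv huv => by
    have := hf u hu v hv
    rw [huv, dist_self, mul_zero] at this
    exact dist_le_zero.1 this
  have hlip : LipschitzOnWith A (Function.invFunOn f (Metric.ball 0 1)) (f '' Metric.ball 0 1) := by
    refine LipschitzOnWith.of_dist_le_mul ?_
    rintro _ ⟨u, hu, rfl⟩ _ ⟨v, hv, rfl⟩
    rw [hinj.leftInvOn_invFunOn hu, hinj.leftInvOn_invFunOn hv]
    exact hf u hu v hv
  have hle := hlip.hausdorffMeasure_image_le (d := d) (Nat.cast_nonneg _)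
  rw [hinj.invFunOn_image Subset.rfl] at hle
  exact absurd (hle.trans (mul_le_mul_right (measure_mono himg) _)) (not_le.2 hk)

/-- The image of a ball under a bi-Lipschitz map between spaces of the same dimension has a unique
differential at the image of the centre. -/
theorem uniqueDiffWithinAt_image_ball {f : E → E} {u₀ : E} {r : ℝ} (hr : 0 < r) {A L : ℝ≥0}
    (hA : ∀ u ∈ Metric.ball u₀ r, ∀ v ∈ Metric.ball u₀ r, dist u v ≤ A * dist (f u) (f v))
    (hL : ∀ u ∈ Metric.ball u₀ r, dist (f u) (f u₀) ≤ L * dist u u₀) :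
    UniqueDiffWithinAt ℝ (f '' Metric.ball u₀ r) (f u₀) := by
  have hmem : f u₀ ∈ f '' Metric.ball u₀ r := mem_image_of_mem _ (Metric.mem_ball_self hr)
  refine ⟨?_, subset_closure hmem⟩
  set W := Submodule.span ℝ (tangentConeAt ℝ (f '' Metric.ball u₀ r) (f u₀)) with hW
  suffices h : W = ⊤ by
    rw [h]
    exact dense_univ
  by_contra hne
  -- Suppose the tangent cone lies in a hyperplane `ker e`. The blow-ups of `f` at `u₀` satisfy the
  -- same two bounds at every scale, so each has a value with `|e|` above a fixed `ε`. A limit of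
  -- these values is a tangent vector outside `ker e`.
  obtain ⟨g, hg0, hgW⟩ := W.exists_le_ker_of_lt_top (lt_top_iff_ne_top.2 hne)
  let e : E →L[ℝ] ℝ := LinearMap.toContinuousLinearMap g
  have he : e ≠ 0 := fun h => hg0 (by
    ext y
    exact DFunLike.congr_fun h y)
  obtain ⟨ε, hε, hslab⟩ := exists_slab_width e he A L
  let ρ : ℕ → ℝ := fun k => r * (1 / ((k : ℝ) + 1))
  have hρ : ∀ k, 0 < ρ k := fun k => by positivity
  have hρr : ∀ k, ρ k ≤ r := fun k => by
    have : 1 / ((k : ℝ) + 1) ≤ 1 := by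
      rw [div_le_one (by positivity)]
      linarith [(Nat.cast_nonneg k : (0 : ℝ) ≤ k)]
    exact mul_le_of_le_one_right hr.le this
  have hin : ∀ k, ∀ w ∈ Metric.ball (0 : E) 1, u₀ + ρ k • w ∈ Metric.ball u₀ r := by
    intro k w hw
    rw [mem_ball_iff_norm, add_sub_cancel_left, norm_smul, Real.norm_of_nonneg (hρ k).le]
    have := mem_ball_zero_iff.1 hw
    calc ρ k * ‖w‖ < ρ k * 1 := mul_lt_mul_of_pos_left this (hρ k)
      _ ≤ r := by simpa using hρr k
  have hLw : ∀ k, ∀ w ∈ Metric.ball (0 : E) 1,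
      ‖(ρ k)⁻¹ • (f (u₀ + ρ k • w) - f u₀)‖ ≤ L := by
    intro k w hw
    have h1 := hL _ (hin k w hw)
    rw [dist_eq_norm, dist_eq_norm, add_sub_cancel_left, norm_smul,
      Real.norm_of_nonneg (hρ k).le] at h1
    rw [norm_smul, norm_inv, Real.norm_of_nonneg (hρ k).le, inv_mul_le_iff₀ (hρ k)]
    have h2 := (mem_ball_zero_iff.1 hw).le
    have h3 : (L : ℝ) * ρ k * ‖w‖ ≤ L * ρ k * 1 :=
      mul_le_mul_of_nonneg_left h2 (mul_nonneg L.coe_nonneg (hρ k).le)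
    linarith
  have hex : ∀ k, ∃ w ∈ Metric.ball (0 : E) 1,
      ε < |e ((ρ k)⁻¹ • (f (u₀ + ρ k • w) - f u₀))| := by
    intro k
    refine hslab (fun w => (ρ k)⁻¹ • (f (u₀ + ρ k • w) - f u₀)) (fun u hu v hv => ?_) (hLw k)
    have h1 := hA _ (hin k u hu) _ (hin k v hv)
    rw [dist_add_left, dist_smul₀, Real.norm_of_nonneg (hρ k).le] at h1
    rw [dist_smul₀, dist_sub_right, norm_inv, Real.norm_of_nonneg (hρ k).le, ← mul_assoc,
      mul_comm (A : ℝ), mul_assoc, ← div_eq_inv_mul, le_div_iff₀ (hρ k)]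
    linarith
  choose w hw hew using hex
  obtain ⟨v, -, φ, hφ, hv⟩ := (isCompact_closedBall (0 : E) L).tendsto_subseq
    (x := fun k => (ρ k)⁻¹ • (f (u₀ + ρ k • w k) - f u₀))
    (fun k => mem_closedBall_zero_iff.2 (hLw k _ (hw k)))
  have hvT : v ∈ tangentConeAt ℝ (f '' Metric.ball u₀ r) (f u₀) := by
    refine mem_tangentConeAt_of_seq atTop (fun k => (ρ (φ k))⁻¹)
      (fun k => f (u₀ + ρ (φ k) • w (φ k)) - f u₀) ?_ (Eventually.of_forall fun k => ?_) hv
    · have h1 : Tendsto ρ atTop (𝓝 0) := by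
        simpa [ρ] using tendsto_one_div_add_atTop_nhds_zero_nat.const_mul r
      refine squeeze_zero_norm (a := fun k => ρ (φ k) * L) (fun k => ?_) ?_
      · have := hLw (φ k) _ (hw (φ k))
        rwa [norm_smul, norm_inv, Real.norm_of_nonneg (hρ _).le, inv_mul_le_iff₀ (hρ _)] at this
      · simpa using (h1.comp hφ.tendsto_atTop).mul_const (L : ℝ)
    · rw [add_sub_cancel]
      exact mem_image_of_mem _ (hin _ _ (hw _))
  have hev : e v = 0 := hgW (Submodule.subset_span hvT)
  have hlim : Tendsto (fun k => |e ((ρ (φ k))⁻¹ • (f (u₀ + ρ (φ k) • w (φ k)) - f u₀))|) atTop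
      (𝓝 |e v|) := ((e.continuous.tendsto v).comp hv).abs
  have := ge_of_tendsto' hlim fun k => (hew (φ k)).le
  rw [hev, abs_zero] at this
  linarith

end UniqueDiff

/-! ### Canonical coordinates of `T*M` over charts of `M` -/

section CotangentCoordinates

variable {n : ℕ} {M : Type*} [TopologicalSpace M] [ChartedSpace (Model n) M]
  [IsManifold (𝓡 n) ∞ M]

/-- The coordinates of a covector in the trivialization of `T*M` over the chart centred at `c`. -/
def covCoord (c : M) (k : Cotangent n M) : Model n →L[ℝ] ℝ :=
  (trivializationAt (Model n →L[ℝ] ℝ)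
    (fun x : M => TangentSpace (𝓡 n) x →L[ℝ] Bundle.Trivial M ℝ x) c k).2

/-- The canonical coordinates of `T*M` over the chart centred at `c`. -/
def cotCoord (c : M) (k : Cotangent n M) : Model n × (Model n →L[ℝ] ℝ) :=
  (extChartAt (𝓡 n) c k.proj, covCoord c k)

/-- The preferred chart of `T*M` depends only on the base point of its centre, so computations can
be done in coordinates indexed by points of `M`. -/
theorem coe_extChartAt_cotModel (k₀ : Cotangent n M) :
    ⇑(extChartAt (cotModel n) k₀) = cotCoord k₀.proj := by
  rw [FiberBundle.extChartAt]
  rfl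

theorem mem_chartAt_cotModel_source {k₀ k : Cotangent n M} :
    k ∈ (chartAt (ModelProd (Model n) (Model n →L[ℝ] ℝ)) k₀).source ↔
      k.proj ∈ (chartAt (Model n) k₀.proj).source := by
  rw [FiberBundle.chartedSpace_chartAt]
  simp only [mfld_simps]
  exact ⟨fun h => h.1.1, fun h => ⟨⟨h, by trivial⟩, h⟩⟩

/-- A tangent space of `M` is the model space read in the chart centred at its own point. Passing to
the chart centred at `c` therefore means precomposing the covector with a tangent coordinate change.
-/
theorem covCoord_apply {c : M} {k : Cotangent n M} (hk : k.proj ∈ (chartAt (Model n) c).source)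
    (v : Model n) : covCoord c k v = k.2 (tangentCoordChange (𝓡 n) c k.proj k.proj v) := by
  rw [covCoord, hom_trivializationAt_apply]
  simp only [ContinuousLinearMap.inCoordinates]
  rw [TangentBundle.symmL_trivializationAt_eq_core hk]
  have : ∀ w : ℝ, (Trivialization.continuousLinearMapAt ℝ
    (trivializationAt ℝ (Bundle.Trivial M ℝ) c) k.proj) w = w := by
    intro w
    rw [Trivialization.continuousLinearMapAt_apply, Trivialization.linearMapAt_apply]
    rw [if_pos (by trivial)]
    rfl
  exact this _

theorem covCoord_self_apply (k : Cotangent n M) (v : Model n) : covCoord k.proj k v = k.2 v := by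
  rw [covCoord_apply (mem_chart_source _ _)]
  exact congrArg _ (tangentCoordChange_self (mem_extChartAt_source _))

theorem covCoord_apply_eq {c c' : M} {k : Cotangent n M}
    (hk : k.proj ∈ (chartAt (Model n) c).source) (hk' : k.proj ∈ (chartAt (Model n) c').source)
    (v : Model n) :
    covCoord c k v = covCoord c' k (tangentCoordChange (𝓡 n) c c' k.proj v) := by
  rw [covCoord_apply hk, covCoord_apply hk', tangentCoordChange_comp]
  simp [hk, hk']

/-- The change of coordinates from the chart centred at `c` to the chart centred at `c'`. -/
def chartChange (n : ℕ) {M : Type*} [TopologicalSpace M] [ChartedSpace (Model n) M] (c c' : M) :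
    Model n → Model n :=
  extChartAt (𝓡 n) c' ∘ (extChartAt (𝓡 n) c).symm

theorem contDiffAt_chartChange {c c' y : M} (hy : y ∈ (chartAt (Model n) c).source)
    (hy' : y ∈ (chartAt (Model n) c').source) :
    ContDiffAt ℝ ∞ (chartChange n c c') (extChartAt (𝓡 n) c y) := by
  have h : extChartAt (𝓡 n) c y ∈
      ((extChartAt (𝓡 n) c).symm ≫ (extChartAt (𝓡 n) c')).source := by
    rw [PartialEquiv.trans_source'', PartialEquiv.symm_symm, PartialEquiv.symm_target]
    exact mem_image_of_mem _ ⟨by simpa using hy, by simpa using hy'⟩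
  have := contDiffWithinAt_ext_coord_change (I := 𝓡 n) (n := ∞) c' c h
  rwa [ModelWithCorners.range_eq_univ, contDiffWithinAt_univ] at this

theorem fderiv_chartChange (c c' y : M) :
    fderiv ℝ (chartChange n c c') (extChartAt (𝓡 n) c y) = tangentCoordChange (𝓡 n) c c' y := by
  rw [tangentCoordChange_def, ModelWithCorners.range_eq_univ, fderivWithin_univ]
  rfl

omit [IsManifold (𝓡 n) ∞ M] in
theorem chartChange_extChartAt {c y : M} (c' : M) (hy : y ∈ (chartAt (Model n) c).source) :
    chartChange n c c' (extChartAt (𝓡 n) c y) = extChartAt (𝓡 n) c' y := by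
  rw [chartChange, Function.comp_apply,
    (extChartAt (𝓡 n) c).left_inv ((extChartAt_source (𝓡 n) c).symm ▸ hy)]

theorem eventually_mem_chartAt_source {c : M} {k : Cotangent n M}
    (hk : k.proj ∈ (chartAt (Model n) c).source) :
    ∀ᶠ k' : Cotangent n M in 𝓝 k, k'.proj ∈ (chartAt (Model n) c).source :=
  (FiberBundle.continuous_proj (Model n →L[ℝ] ℝ)
    (fun x : M => TangentSpace (𝓡 n) x →L[ℝ] Bundle.Trivial M ℝ x)).continuousAt.eventually
    ((chartAt (Model n) c).open_source.mem_nhds hk)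

theorem continuousAt_cotCoord {c : M} {k : Cotangent n M}
    (hk : k.proj ∈ (chartAt (Model n) c).source) : ContinuousAt (cotCoord c) k := by
  rw [← coe_extChartAt_cotModel (⟨c, 0⟩ : Cotangent n M)]
  exact continuousAt_extChartAt' (by
    rw [extChartAt_source]; exact mem_chartAt_cotModel_source.2 hk)

/-- The differential of the canonical coordinates over the chart centred at `c`. -/
def dCot (c : M) (k : Cotangent n M) :
    TangentSpace (cotModel n) k →L[ℝ] (Model n × (Model n →L[ℝ] ℝ)) :=
  mfderiv (cotModel n) 𝓘(ℝ, Model n × (Model n →L[ℝ] ℝ)) (cotCoord c) k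

theorem dCoord_eq_dCot (k : Cotangent n M) : dCoord k = dCot k.proj k := by
  rw [dCoord, dCot, coe_extChartAt_cotModel]

theorem hasMFDerivAt_cotCoord {c : M} {k : Cotangent n M}
    (hk : k.proj ∈ (chartAt (Model n) c).source) :
    HasMFDerivAt (cotModel n) 𝓘(ℝ, Model n × (Model n →L[ℝ] ℝ)) (cotCoord c) k (dCot c k) := by
  refine MDifferentiableAt.hasMFDerivAt ?_
  rw [← coe_extChartAt_cotModel (⟨c, 0⟩ : Cotangent n M)]
  exact mdifferentiableAt_extChartAt (mem_chartAt_cotModel_source.2 hk)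

theorem dCot_surjective {c : M} {k : Cotangent n M}
    (hk : k.proj ∈ (chartAt (Model n) c).source) : Function.Surjective (dCot c k) := by
  obtain ⟨e, he⟩ : (dCot c k).IsInvertible := by
    rw [dCot, ← coe_extChartAt_cotModel (⟨c, 0⟩ : Cotangent n M)]
    exact isInvertible_mfderiv_extChartAt (by
      rw [extChartAt_source]; exact mem_chartAt_cotModel_source.2 hk)
  rw [← he]
  exact e.surjective

/-- The inverse of the canonical coordinates over the chart centred at `c`. -/
def cotCoordSymm (c : M) : Model n × (Model n →L[ℝ] ℝ) → Cotangent n M :=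
  (extChartAt (cotModel n) (⟨c, 0⟩ : Cotangent n M)).symm

theorem cotCoordSymm_cotCoord {c : M} {k : Cotangent n M}
    (hk : k.proj ∈ (chartAt (Model n) c).source) : cotCoordSymm c (cotCoord c k) = k := by
  have := (extChartAt (cotModel n) (⟨c, 0⟩ : Cotangent n M)).left_inv (x := k)
    (by rw [extChartAt_source]; exact mem_chartAt_cotModel_source.2 hk)
  rwa [coe_extChartAt_cotModel] at this

theorem mdifferentiableAt_cotCoordSymm {c : M} {k : Cotangent n M}
    (hk : k.proj ∈ (chartAt (Model n) c).source) :
    MDifferentiableAt 𝓘(ℝ, Model n × (Model n →L[ℝ] ℝ)) (cotModel n) (cotCoordSymm c)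
      (cotCoord c k) := by
  have hs : k ∈ (extChartAt (cotModel n) (⟨c, 0⟩ : Cotangent n M)).source := by
    rw [extChartAt_source]; exact mem_chartAt_cotModel_source.2 hk
  have ht := (extChartAt (cotModel n) (⟨c, 0⟩ : Cotangent n M)).map_source hs
  have := mdifferentiableWithinAt_extChartAt_symm ht
  rw [ModelWithCorners.range_eq_univ, mdifferentiableWithinAt_univ,
    coe_extChartAt_cotModel] at this
  exact this

end CotangentCoordinates

/-! ### Symplectic form, Liouville form and Hamiltonian fields in coordinates -/

section SymplecticCoordinates

variable {n : ℕ} {M : Type*} [TopologicalSpace M] [ChartedSpace (Model n) M]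
  [IsManifold (𝓡 n) ∞ M]

theorem HasMFDerivAt.hasFDerivAt_comp {E G G' : Type*} [NormedAddCommGroup E] [NormedSpace ℝ E]
    {H : Type*} [TopologicalSpace H] {I : ModelWithCorners ℝ E H} {X : Type*} [TopologicalSpace X]
    [ChartedSpace H X] [NormedAddCommGroup G] [NormedSpace ℝ G] [NormedAddCommGroup G']
    [NormedSpace ℝ G'] {f : X → G} {k : X} {f' : TangentSpace I k →L[ℝ] G} {g : G → G'}
    {g' : G →L[ℝ] G'} (hg : HasFDerivAt g g' (f k)) (hf : HasMFDerivAt I 𝓘(ℝ, G) f k f') :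
    HasMFDerivAt I 𝓘(ℝ, G') (g ∘ f) k (g'.comp f') :=
  hg.hasMFDerivAt.comp k hf

/-- The transformation law of the canonical coordinates of tangent vectors of `T*M` under a change
of the chart of `M`. -/
theorem dCot_change {c c' : M} {k : Cotangent n M} (hk : k.proj ∈ (chartAt (Model n) c).source)
    (hk' : k.proj ∈ (chartAt (Model n) c').source) (X : TangentSpace (cotModel n) k) :
    (dCot c' k X).1 = tangentCoordChange (𝓡 n) c c' k.proj (dCot c k X).1 ∧
    ∀ v, (dCot c k X).2 v = (dCot c' k X).2 (tangentCoordChange (𝓡 n) c c' k.proj v) +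
      covCoord c' k (fderiv ℝ (fderiv ℝ (chartChange n c c')) (extChartAt (𝓡 n) c k.proj)
        (dCot c k X).1 v) := by
  have hT := contDiffAt_chartChange hk hk'
  have hA := hasMFDerivAt_cotCoord hk
  have hA' := hasMFDerivAt_cotCoord hk'
  have hW := (hA.mdifferentiableAt.prodMk_space hA'.mdifferentiableAt).hasMFDerivAt
  -- Both coordinate systems are bundled because the law for the fibre coordinate, `p = p' ∘ DT(x)`,
  -- mixes `p'` from one and `x` from the other; its differential contains the second derivative of
  -- the chart change `T`.
  set W : Cotangent n M → (Model n × (Model n →L[ℝ] ℝ)) × (Model n × (Model n →L[ℝ] ℝ)) :=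
    fun k => (cotCoord c k, cotCoord c' k)
  let W' : TangentSpace (cotModel n) k →L[ℝ]
    (Model n × (Model n →L[ℝ] ℝ)) × (Model n × (Model n →L[ℝ] ℝ)) :=
    mfderiv (cotModel n) 𝓘(ℝ, _) W k
  have h1 : (W' X).1 = dCot c k X := by
    have := HasMFDerivAt.hasFDerivAt_comp (hasFDerivAt_fst (𝕜 := ℝ) (p := W k)) hW
    exact DFunLike.congr_fun (hasMFDerivAt_unique this hA) X
  have h2 : (W' X).2 = dCot c' k X := by
    have := HasMFDerivAt.hasFDerivAt_comp (hasFDerivAt_snd (𝕜 := ℝ) (p := W k)) hW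
    exact DFunLike.congr_fun (hasMFDerivAt_unique this hA') X
  have hTd : HasFDerivAt (chartChange n c c') (tangentCoordChange (𝓡 n) c c' k.proj)
      (extChartAt (𝓡 n) c k.proj) := by
    rw [← fderiv_chartChange]
    exact (hT.differentiableAt (by simp)).hasFDerivAt
  have hDT : HasFDerivAt (fderiv ℝ (chartChange n c c'))
      (fderiv ℝ (fderiv ℝ (chartChange n c c')) (extChartAt (𝓡 n) c k.proj))
      (extChartAt (𝓡 n) c k.proj) :=
    ((hT.fderiv_right (m := ∞) (by simp)).differentiableAt (by simp)).hasFDerivAt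
  constructor
  · have e1 := HasMFDerivAt.hasFDerivAt_comp (f := cotCoord c)
      (hTd.comp (cotCoord c k) (hasFDerivAt_fst (𝕜 := ℝ) (p := cotCoord c k))) hA
    have e2 := HasMFDerivAt.hasFDerivAt_comp (hasFDerivAt_fst (𝕜 := ℝ) (p := cotCoord c' k)) hA'
    have e3 := e2.congr_of_eventuallyEq (f₁ := (chartChange n c c' ∘ Prod.fst) ∘ cotCoord c) (by
      filter_upwards [eventually_mem_chartAt_source hk] with k' hk'
      exact chartChange_extChartAt c' hk')
    exact (DFunLike.congr_fun (hasMFDerivAt_unique e1 e3) X).symm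
  · intro v
    have hg := (hasFDerivAt_snd (𝕜 := ℝ) (p := (W k).2)).comp (W k) hasFDerivAt_snd |>.clm_comp
      (hDT.comp (W k) ((hasFDerivAt_fst (𝕜 := ℝ) (p := (W k).1)).comp (W k) hasFDerivAt_fst))
    have e1 := HasMFDerivAt.hasFDerivAt_comp (f := W) hg hW
    have e2 := HasMFDerivAt.hasFDerivAt_comp (hasFDerivAt_snd (𝕜 := ℝ) (p := cotCoord c k)) hA
    have e3 := e1.congr_of_eventuallyEq (f₁ := Prod.snd ∘ cotCoord c) (by
      filter_upwards [eventually_mem_chartAt_source hk, eventually_mem_chartAt_source hk']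
        with l hl hl'
      ext v
      exact (covCoord_apply_eq hl hl' v).trans (by rw [← fderiv_chartChange]; rfl))
    have e4 := DFunLike.congr_fun (hasMFDerivAt_unique e2 e3) X
    have e5 : (dCot c k X).2 v = _ := congrArg (fun A : Model n →L[ℝ] ℝ => A v) e4
    refine e5.trans ?_
    rw [← h1, ← h2, ← fderiv_chartChange]
    exact add_comm _ _

/-- The canonical symplectic form in the canonical coordinates over any chart of `M`. -/
theorem symplecticForm_eq_dCot {c : M} {k : Cotangent n M}
    (hk : k.proj ∈ (chartAt (Model n) c).source) (v w : TangentSpace (cotModel n) k) :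
    symplecticForm k v w =
      (dCot c k v).2 (dCot c k w).1 - (dCot c k w).2 (dCot c k v).1 := by
  have hv := dCot_change hk (mem_chart_source (Model n) k.proj) v
  have hw := dCot_change hk (mem_chart_source (Model n) k.proj) w
  -- The second derivatives of the chart change cancel in the antisymmetric form by their symmetry.
  have hsymm := (contDiffAt_chartChange hk (mem_chart_source (Model n) k.proj)).isSymmSndFDerivAt
    (by rw [minSmoothness_of_isRCLikeNormedField]; exact WithTop.coe_le_coe.2 le_top) (dCot c k v).1 (dCot c k w).1
  rw [symplecticForm, dCoord_eq_dCot, hv.1, hw.1, hv.2, hw.2, hsymm]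
  ring

/-- The Liouville form in the canonical coordinates over any chart of `M`. -/
theorem liouvilleForm_eq_dCot {c : M} {k : Cotangent n M}
    (hk : k.proj ∈ (chartAt (Model n) c).source) (v : TangentSpace (cotModel n) k) :
    liouvilleForm k v = covCoord c k (dCot c k v).1 := by
  rw [covCoord_apply hk, ← (dCot_change hk (mem_chart_source (Model n) k.proj) v).1]
  have hA := HasMFDerivAt.hasFDerivAt_comp (hasFDerivAt_fst (𝕜 := ℝ) (p := cotCoord k.proj k))
    (hasMFDerivAt_cotCoord (mem_chart_source (Model n) k.proj))
  have hproj : MDifferentiableAt (cotModel n) (𝓡 n) (fun k : Cotangent n M => k.proj) k :=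
    (contMDiffAt_proj (n := 1) _).mdifferentiableAt one_ne_zero
  have hc : HasMFDerivAt (cotModel n) 𝓘(ℝ, Model n) (Prod.fst ∘ cotCoord k.proj) k
      ((mfderiv (𝓡 n) 𝓘(ℝ, Model n) (extChartAt (𝓡 n) k.proj) k.proj).comp
        (mfderiv (cotModel n) (𝓡 n) (fun k : Cotangent n M => k.proj) k)) :=
    (mdifferentiableAt_extChartAt (mem_chart_source (Model n) k.proj)).hasMFDerivAt.comp k
      hproj.hasMFDerivAt
  rw [mfderiv_extChartAt_self] at hc
  exact congrArg k.2 (DFunLike.congr_fun (hasMFDerivAt_unique hc hA) v)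

/-- The first-order expansion of a Hamiltonian, written by means of its Hamiltonian vector field in
the canonical coordinates over a chart of `M`. -/
theorem hamiltonian_sub_isLittleO {c : M} {k : Cotangent n M}
    (hk : k.proj ∈ (chartAt (Model n) c).source) {h : Cotangent n M → ℝ}
    (hh : MDifferentiableAt (cotModel n) 𝓘(ℝ, ℝ) h k) :
    (fun l => h l - h k -
      ((covCoord c l - covCoord c k) (dCot c k (hamiltonianField h k)).1 -
        (dCot c k (hamiltonianField h k)).2
          (extChartAt (𝓡 n) c l.proj - extChartAt (𝓡 n) c k.proj))) =o[𝓝 k]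
      fun l => cotCoord c l - cotCoord c k := by
  have hs := mdifferentiableAt_cotCoordSymm hk
  have hh' : MDifferentiableAt (cotModel n) 𝓘(ℝ, ℝ) h (cotCoordSymm c (cotCoord c k)) := by
    rwa [cotCoordSymm_cotCoord hk]
  have hcomp := (hh'.comp (cotCoord c k) hs).differentiableAt.hasFDerivAt
  set g' := fderiv ℝ (h ∘ cotCoordSymm c) (cotCoord c k)
  have e1 := (HasMFDerivAt.hasFDerivAt_comp hcomp (hasMFDerivAt_cotCoord hk))
  have e2 := e1.congr_of_eventuallyEq (f₁ := h) (by
    filter_upwards [eventually_mem_chartAt_source hk] with l hl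
    simp only [Function.comp_apply]
    rw [cotCoordSymm_cotCoord hl])
  have e3 : ∀ v, dFun h k v = g' (dCot c k v) := fun v =>
    DFunLike.congr_fun (hasMFDerivAt_unique hh.hasMFDerivAt e2) v
  -- Hamilton's equations in coordinates; every coordinate vector comes from a tangent vector, so
  -- the defining relation of the field determines `g'`.
  have e4 : ∀ z : Model n × (Model n →L[ℝ] ℝ), g' z = z.2 (dCot c k (hamiltonianField h k)).1 -
      (dCot c k (hamiltonianField h k)).2 z.1 := by
    intro z
    obtain ⟨v, rfl⟩ := dCot_surjective hk z
    rw [← e3, hamiltonianField_spec, symplecticForm_eq_dCot hk]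
  have e5 := (hasFDerivAt_iff_isLittleO.1 hcomp).comp_tendsto (continuousAt_cotCoord hk)
  refine e5.congr' ?_ (Eventually.of_forall fun _ => rfl)
  filter_upwards [eventually_mem_chartAt_source hk] with l hl
  simp only [Function.comp_apply]
  rw [cotCoordSymm_cotCoord hl, cotCoordSymm_cotCoord hk, e4]
  rfl

/-- The velocity of a curve in `T*M` in the canonical coordinates over a chart of `M`. -/
theorem hasDerivAt_cotCoord {c : M} {γ : ℝ → Cotangent n M} {s : ℝ}
    (hk : (γ s).proj ∈ (chartAt (Model n) c).source) {X : TangentSpace (cotModel n) (γ s)}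
    (hγ : HasMFDerivAt 𝓘(ℝ, ℝ) (cotModel n) γ s ((1 : ℝ →L[ℝ] ℝ).smulRight X)) :
    HasDerivAt (fun s => cotCoord c (γ s)) (dCot c (γ s) X) s := by
  let A : ℝ →L[ℝ] Model n × (Model n →L[ℝ] ℝ) :=
    (dCot c (γ s)).comp ((1 : ℝ →L[ℝ] ℝ).smulRight X)
  have h : HasFDerivAt (fun s => cotCoord c (γ s)) A s :=
    ((hasMFDerivAt_cotCoord hk).comp s hγ).hasFDerivAt
  refine h.hasDerivAt.congr_deriv ?_
  change dCot c (γ s) ((1 : ℝ) • X) = _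
  rw [one_smul]

end SymplecticCoordinates

/-! ### Segments with clamped parameter, which make curves along them globally Lipschitz -/

section Segments

/-- The segment from `u` to `v`, run through during the time interval `[0, 1]`. -/
def clampedSegment {E : Type*} [NormedAddCommGroup E] [NormedSpace ℝ E] (u v : E) (τ : ℝ) : E :=
  u + (projIcc (0 : ℝ) 1 zero_le_one τ : ℝ) • (v - u)

variable {E : Type*} [NormedAddCommGroup E] [NormedSpace ℝ E]

@[simp] theorem clampedSegment_zero (u v : E) : clampedSegment u v 0 = u := by
  simp [clampedSegment]

@[simp] theorem clampedSegment_one (u v : E) : clampedSegment u v 1 = v := by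
  simp [clampedSegment]

theorem clampedSegment_mem {s : Set E} (hs : Convex ℝ s) {u v : E} (hu : u ∈ s) (hv : v ∈ s)
    (τ : ℝ) : clampedSegment u v τ ∈ s :=
  hs.add_smul_sub_mem hu hv (projIcc (0 : ℝ) 1 zero_le_one τ).2

theorem norm_projIcc_sub_le {a b : ℝ} (hab : a ≤ b) (s t : ℝ) :
    ‖(projIcc a b hab s : ℝ) - projIcc a b hab t‖ ≤ ‖s - t‖ := by
  have := (LipschitzWith.projIcc hab).dist_le_mul s t
  simpa [Subtype.dist_eq, Real.dist_eq] using this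

theorem norm_clampedSegment_sub_le (u v : E) (σ τ : ℝ) :
    ‖clampedSegment u v σ - clampedSegment u v τ‖ ≤ ‖v - u‖ * ‖σ - τ‖ := by
  rw [clampedSegment, clampedSegment, add_sub_add_left_eq_sub, ← sub_smul, norm_smul, mul_comm]
  exact mul_le_mul_of_nonneg_left (norm_projIcc_sub_le _ _ _) (norm_nonneg _)

theorem norm_clampedSegment_sub_left_le (u v : E) (τ : ℝ) :
    ‖clampedSegment u v τ - u‖ ≤ ‖v - u‖ := by
  rw [clampedSegment, add_sub_cancel_left, norm_smul]
  refine mul_le_of_le_one_left (norm_nonneg _) ?_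
  rw [Real.norm_of_nonneg (projIcc (0 : ℝ) 1 zero_le_one τ).2.1]
  exact (projIcc (0 : ℝ) 1 zero_le_one τ).2.2

theorem clampedSegment_isBigO (u v : E) (τ : ℝ) :
    (fun σ => clampedSegment u v σ - clampedSegment u v τ) =O[𝓝 τ] fun σ => σ - τ :=
  Asymptotics.IsBigO.of_bound ‖v - u‖
    (Eventually.of_forall fun σ => norm_clampedSegment_sub_le u v σ τ)

theorem continuous_clampedSegment (u v : E) : Continuous (clampedSegment u v) := by
  unfold clampedSegment
  fun_prop

theorem LipschitzWith.fst_apply {X A B : Type*} [PseudoEMetricSpace X] [PseudoEMetricSpace A]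
    [PseudoEMetricSpace B] {C : ℝ≥0} {f : X → A × B} (hf : LipschitzWith C f) :
    LipschitzWith C fun x => (f x).1 := one_mul C ▸ LipschitzWith.prod_fst.comp hf

theorem LipschitzWith.snd_apply {X A B : Type*} [PseudoEMetricSpace X] [PseudoEMetricSpace A]
    [PseudoEMetricSpace B] {C : ℝ≥0} {f : X → A × B} (hf : LipschitzWith C f) :
    LipschitzWith C fun x => (f x).2 := one_mul C ▸ LipschitzWith.prod_snd.comp hf

theorem LipschitzOnWith.comp_clampedSegment {G : Type*} [NormedAddCommGroup G] {C : ℝ≥0}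
    {f : E → G} {s : Set E} (hf : LipschitzOnWith C f s) (hs : Convex ℝ s) {u v : E} (hu : u ∈ s)
    (hv : v ∈ s) : LipschitzWith (C * ‖v - u‖₊) (f ∘ clampedSegment u v) := by
  refine LipschitzWith.of_dist_le_mul fun σ τ => ?_
  have h1 := hf.dist_le_mul _ (clampedSegment_mem hs hu hv σ) _ (clampedSegment_mem hs hu hv τ)
  have h2 := norm_clampedSegment_sub_le u v σ τ
  rw [dist_eq_norm (clampedSegment u v σ)] at h1
  rw [dist_eq_norm σ τ]
  refine h1.trans ((mul_le_mul_of_nonneg_left h2 C.coe_nonneg).trans_eq ?_)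
  push_cast
  ring

theorem LipschitzOnWith.isBigO_sub_nhds {E G : Type*} [NormedAddCommGroup E]
    [NormedAddCommGroup G] {C : ℝ≥0} {f : E → G} {s : Set E} (hf : LipschitzOnWith C f s) {u : E} (hs : s ∈ 𝓝 u) :
    (fun v => f v - f u) =O[𝓝 u] fun v => v - u := by
  refine Asymptotics.IsBigO.of_bound C ?_
  filter_upwards [hs] with v hv
  have := hf.dist_le_mul _ hv _ (mem_of_mem_nhds hs)
  rwa [dist_eq_norm, dist_eq_norm] at this

theorem continuousAt_of_isBigO_sub {E G : Type*} [NormedAddCommGroup E] [NormedAddCommGroup G]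
    {f : E → G} {u : E}
    (h : (fun v => f v - f u) =O[𝓝 u] fun v => v - u) : ContinuousAt f u := by
  have h0 : Tendsto (fun v => v - u) (𝓝 u) (𝓝 0) := by
    simpa using (continuous_id.sub continuous_const).tendsto (f := fun v : E => v - u) u
  exact tendsto_sub_nhds_zero_iff.1 (h.trans_tendsto h0)

end Segments

/-! ### Primitives of `p dx`: pointwise and integrated forms -/

section LocalAction

variable {E F : Type*} [NormedAddCommGroup E] [NormedSpace ℝ E] [NormedAddCommGroup F]
  [NormedSpace ℝ F] [FiniteDimensional ℝ F]

/-- The integral of `p dx` along the image of the segment from `u` to `v` under `z = (x, p)`. -/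
def segmentAction (z : E → F × (F →L[ℝ] ℝ)) (u v : E) : ℝ :=
  ∫ τ in (0 : ℝ)..1, (z (clampedSegment u v τ)).2
    (deriv (fun σ => (z (clampedSegment u v σ)).1) τ)

variable {z : E → F × (F →L[ℝ] ℝ)} {s : Set E} {C : ℝ≥0} {f : E → ℝ}

/-- A function whose differential is `p dx` is a primitive of `p dx` along segments. -/
theorem sub_eq_segmentAction (hs : Convex ℝ s) (ho : IsOpen s) (hz : LipschitzOnWith C z s)
    (hf : ∀ u ∈ s, (fun v => f v - f u - (z u).2 ((z v).1 - (z u).1)) =o[𝓝 u] fun v => v - u)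
    {u v : E} (hu : u ∈ s) (hv : v ∈ s) : f v - f u = segmentAction z u v := by
  have hL := hz.comp_clampedSegment hs hu hv
  have hx : LipschitzWith (C * ‖v - u‖₊) (fun τ => (z (clampedSegment u v τ)).1) :=
    hL.fst_apply
  have hp : LipschitzWith (C * ‖v - u‖₊) (fun τ => (z (clampedSegment u v τ)).2) :=
    hL.snd_apply
  -- `f` is not assumed Lipschitz. Its expansion at each point, with Lipschitz `x`, gives the
  -- pointwise growth bound that the fundamental theorem needs.
  have hfO : ∀ w ∈ s, (fun v => f v - f w) =O[𝓝 w] fun v => v - w := by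
    intro w hw
    have h1 : (fun v => (z v).1 - (z w).1) =O[𝓝 w] fun v => v - w :=
      (Asymptotics.isBigO_of_le _ fun v => by
        rw [← Prod.fst_sub]; exact norm_fst_le _).trans (hz.isBigO_sub_nhds (ho.mem_nhds hw))
    have h2 := ((z w).2.isBigO_comp (fun v => (z v).1 - (z w).1) (𝓝 w)).trans h1
    refine ((hf w hw).isBigO.add h2).congr_left fun v => ?_
    ring
  have hO : ∀ τ, (fun σ => f (clampedSegment u v σ) - f (clampedSegment u v τ)) =O[𝓝 τ]
      fun σ => σ - τ := fun τ =>
    ((hfO _ (clampedSegment_mem hs hu hv τ)).comp_tendsto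
      ((continuous_clampedSegment u v).tendsto τ)).trans (clampedSegment_isBigO u v τ)
  have hi := hx.intervalIntegrable_pairing_deriv hp.continuous 0 1
  have := integral_eq_sub_of_isBigO_of_ae_hasDerivAt (g := fun τ => f (clampedSegment u v τ))
    zero_le_one (fun τ _ => (continuousAt_of_isBigO_sub (hO τ)).continuousWithinAt)
    (fun τ _ => (hO τ).mono nhdsWithin_le_nhds)
    ((intervalIntegrable_iff_integrableOn_Icc_of_le zero_le_one).1 hi) ?_
  · simpa [segmentAction] using this.symm
  · filter_upwards [ae_restrict_of_ae hx.ae_differentiableAt_real] with τ hτ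
    refine HasDerivAt.hasDerivWithinAt ?_
    rw [hasDerivAt_iff_isLittleO]
    have h1 := ((hf _ (clampedSegment_mem hs hu hv τ)).comp_tendsto
      ((continuous_clampedSegment u v).tendsto τ)).trans_isBigO (clampedSegment_isBigO u v τ)
    have h2 := ((z (clampedSegment u v τ)).2.isBigO_comp _ _).trans_isLittleO
      (hasDerivAt_iff_isLittleO.1 hτ.hasDerivAt)
    refine (h1.add h2).congr_left fun σ => ?_
    simp only [Function.comp_apply, map_sub, map_smul]
    ring

/-- A primitive of `p dx` along segments has the differential `p dx`. -/
theorem isLittleO_of_sub_eq_segmentAction (hs : Convex ℝ s) (ho : IsOpen s)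
    (hz : LipschitzOnWith C z s) (hf : ∀ u ∈ s, ∀ v ∈ s, f v - f u = segmentAction z u v)
    {u : E} (hu : u ∈ s) :
    (fun v => f v - f u - (z u).2 ((z v).1 - (z u).1)) =o[𝓝 u] fun v => v - u := by
  -- The remainder is the integral of `(p - p(u)) dx` along the segment; the covector increment and
  -- the velocity are each at most `C * ‖v - u‖`.
  have key : (fun v => f v - f u - (z u).2 ((z v).1 - (z u).1)) =O[𝓝 u]
      fun v => ‖v - u‖ * ‖v - u‖ := by
    refine Asymptotics.IsBigO.of_bound (C * C) ?_
    filter_upwards [ho.mem_nhds hu] with v hv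
    have hL := hz.comp_clampedSegment hs hu hv
    have hx : LipschitzWith (C * ‖v - u‖₊) (fun τ => (z (clampedSegment u v τ)).1) :=
    hL.fst_apply
    have hp : LipschitzWith (C * ‖v - u‖₊) (fun τ => (z (clampedSegment u v τ)).2) :=
    hL.snd_apply
    have hconst : ∫ τ in (0 : ℝ)..1, (z u).2 (deriv (fun σ => (z (clampedSegment u v σ)).1) τ) =
        (z u).2 ((z v).1 - (z u).1) := by
      have := integral_pairing_deriv_eq (LipschitzWith.const' (K := 0) (z u).2) hx
        (zero_le_one' ℝ)
      simpa using this
    have hi := hx.intervalIntegrable_pairing_deriv hp.continuous 0 1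
    have hi0 := hx.intervalIntegrable_pairing_deriv
      (continuous_const (y := (z u).2)) 0 1
    rw [hf u hu v hv, segmentAction, ← hconst, ← intervalIntegral.integral_sub hi hi0]
    have hb := intervalIntegral.norm_integral_le_of_norm_le_const (a := (0 : ℝ)) (b := 1)
      (f := fun τ => (z (clampedSegment u v τ)).2
          (deriv (fun σ => (z (clampedSegment u v σ)).1) τ) -
        (z u).2 (deriv (fun σ => (z (clampedSegment u v σ)).1) τ))
      (C := (C * ‖v - u‖) * (C * ‖v - u‖)) fun τ _ => by
        rw [← sub_apply]
        refine norm_pairing_le ?_ ?_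
        · have h1 := hz.dist_le_mul _ (clampedSegment_mem hs hu hv τ) _ hu
          rw [dist_eq_norm, dist_eq_norm] at h1
          refine (norm_snd_le (z (clampedSegment u v τ) - z u)).trans (h1.trans ?_)
          exact mul_le_mul_of_nonneg_left (norm_clampedSegment_sub_left_le u v τ) C.coe_nonneg
        · simpa using norm_deriv_le_of_lipschitz hx (x₀ := τ)
    refine hb.trans (le_of_eq ?_)
    rw [norm_mul, norm_norm]
    simp
    ring
  refine key.trans_isLittleO ?_
  have h0 : Tendsto (fun v => ‖v - u‖) (𝓝 u) (𝓝 0) := by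
    simpa using (continuous_id.sub continuous_const).norm.tendsto (f := fun v : E => ‖v - u‖) u
  have h1 : (fun v => ‖v - u‖) =o[𝓝 u] fun _ => (1 : ℝ) := (Asymptotics.isLittleO_one_iff ℝ).2 h0
  have h2 := h1.mul_isBigO (Asymptotics.isBigO_refl (fun v => ‖v - u‖) (𝓝 u))
  simp only [one_mul] at h2
  exact Asymptotics.isLittleO_norm_right.1 h2

end LocalAction

/-! ### Cartan's formula along a segment of initial values -/

section LocalFlow

variable {E F : Type*} [NormedAddCommGroup E] [NormedSpace ℝ E] [NormedAddCommGroup F]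
  [NormedSpace ℝ F] [FiniteDimensional ℝ F]

/-- Cartan's formula along a segment of initial values, for a Lipschitz flow `z = (x, p)` of
Hamilton's equations with velocity field `V` and energy `K`. -/
theorem integral_sub_eq_segmentAction_sub {z V : ℝ → E → F × (F →L[ℝ] ℝ)} {K g : ℝ → E → ℝ}
    {S : Set E} {C : ℝ≥0} {a b : ℝ} (hab : a ≤ b) (hS : Convex ℝ S) (hSo : IsOpen S)
    (hz : LipschitzOnWith C (Function.uncurry z) (Icc a b ×ˢ S))
    (hK : ∀ᵐ s ∂(volume.restrict (Icc a b)), ∀ u ∈ S,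
      (fun v => K s v - K s u - (((z s v).2 - (z s u).2) (V s u).1 -
        (V s u).2 ((z s v).1 - (z s u).1))) =o[𝓝 u] fun v => z s v - z s u)
    (hV : ∀ u ∈ S, ∀ᵐ s ∂(volume.restrict (Icc a b)), HasDerivAt (fun s => z s u) (V s u) s)
    (hg : ∀ u ∈ S, ∀ s ∈ Icc a b, g s u = (z s u).2 (V s u).1 - K s u)
    (hgi : ∀ u ∈ S, IntegrableOn (fun s => g s u) (Icc a b)) {u v : E} (hu : u ∈ S) (hv : v ∈ S) :
    ∫ s in a..b, (g s v - g s u) = segmentAction (z b) u v - segmentAction (z a) u v := by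
  -- Clamping time as well gives a family Lipschitz on the whole plane. Time derivatives are
  -- compared with those of `z` on the open interval only, where clamping is locally the identity.
  let cl : ℝ → ℝ := fun s => projIcc a b hab s
  let γ := clampedSegment u v
  have hγ : ∀ τ, γ τ ∈ S := clampedSegment_mem hS hu hv
  have hcl : ∀ s, cl s ∈ Icc a b := fun s => (projIcc a b hab s).2
  have hcle : ∀ s ∈ Icc a b, cl s = s := fun s hs => by simp [cl, projIcc_of_mem hab hs]
  have hL : LipschitzWith (C * max 1 ‖v - u‖₊)
      (Function.uncurry fun s τ => z (cl s) (γ τ)) := by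
    refine LipschitzWith.of_dist_le_mul fun w w' => ?_
    have h1 := hz.dist_le_mul (cl w.1, γ w.2) ⟨hcl _, hγ _⟩ (cl w'.1, γ w'.2) ⟨hcl _, hγ _⟩
    refine h1.trans ?_
    push_cast
    rw [mul_assoc]
    refine mul_le_mul_of_nonneg_left ?_ C.coe_nonneg
    have hm : (0 : ℝ) ≤ max 1 ‖v - u‖ := zero_le_one.trans (le_max_left _ _)
    rw [Prod.dist_eq, Prod.dist_eq]
    refine max_le ?_ ?_
    · have h2 : dist (cl w.1) (cl w'.1) ≤ dist w.1 w'.1 := norm_projIcc_sub_le hab _ _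
      calc dist (cl w.1) (cl w'.1) ≤ 1 * max (dist w.1 w'.1) (dist w.2 w'.2) := by
            rw [one_mul]; exact h2.trans (le_max_left _ _)
        _ ≤ _ := mul_le_mul_of_nonneg_right (le_max_left _ _) (dist_nonneg.trans (le_max_left _ _))
    · have h2 : dist (γ w.2) (γ w'.2) ≤ ‖v - u‖ * dist w.2 w'.2 := by
        rw [dist_eq_norm, dist_eq_norm]
        exact norm_clampedSegment_sub_le u v _ _
      exact h2.trans (mul_le_mul (le_max_right _ _) (le_max_right _ _) dist_nonneg hm)
  have hx : LipschitzWith (C * max 1 ‖v - u‖₊)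
      (Function.uncurry fun s τ => (z (cl s) (γ τ)).1) :=
    hL.fst_apply
  have hp : LipschitzWith (C * max 1 ‖v - u‖₊)
      (Function.uncurry fun s τ => (z (cl s) (γ τ)).2) :=
    hL.snd_apply
  have hzs : ∀ s ∈ Icc a b, ∀ w ∈ S, (fun v => z s v - z s w) =O[𝓝 w] fun v => v - w := by
    intro s hs w hw
    have : LipschitzOnWith C (z s) S := LipschitzOnWith.of_dist_le_mul fun v hv v' hv' => by
      simpa [Prod.dist_eq, Function.uncurry] using hz.dist_le_mul (s, v) ⟨hs, hv⟩ (s, v') ⟨hs, hv'⟩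
    exact this.isBigO_sub_nhds (hSo.mem_nhds hw)
  -- The exceptional times of the energy expansion do not depend on `τ`. This gives finite Dini
  -- derivates at every `τ` for one full set of times, whereas those of the velocity in `hder` may
  -- depend on `τ`.
  have hKo : ∀ᵐ s ∂(volume.restrict (Icc a b)), ∀ τ,
      (fun σ => K s (γ σ) - K s (γ τ) - (((z s (γ σ)).2 - (z s (γ τ)).2) (V s (γ τ)).1 -
        (V s (γ τ)).2 ((z s (γ σ)).1 - (z s (γ τ)).1))) =o[𝓝 τ] fun σ => σ - τ := by
    filter_upwards [hK, ae_restrict_mem measurableSet_Icc] with s hs hsI τ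
    exact (((hs _ (hγ τ)).trans_isBigO (hzs s hsI _ (hγ τ))).comp_tendsto
      ((continuous_clampedSegment u v).tendsto τ)).trans_isBigO (clampedSegment_isBigO u v τ)
  have hKO : ∀ᵐ s ∂(volume.restrict (Icc a b)), ∀ τ,
      (fun σ => K s (γ σ) - K s (γ τ)) =O[𝓝 τ] fun σ => σ - τ := by
    filter_upwards [hKo, ae_restrict_mem measurableSet_Icc] with s hs hsI τ
    have h1 : (fun σ => z s (γ σ) - z s (γ τ)) =O[𝓝 τ] fun σ => σ - τ :=
      ((hzs s hsI _ (hγ τ)).comp_tendsto ((continuous_clampedSegment u v).tendsto τ)).trans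
        (clampedSegment_isBigO u v τ)
    have h2 : (fun σ => ((z s (γ σ)).2 - (z s (γ τ)).2) (V s (γ τ)).1) =O[𝓝 τ] fun σ => σ - τ :=
      (((ContinuousLinearMap.apply ℝ ℝ (V s (γ τ)).1).comp
        (ContinuousLinearMap.snd ℝ F (F →L[ℝ] ℝ))).isBigO_comp _ _).trans h1
    have h3 : (fun σ => (V s (γ τ)).2 ((z s (γ σ)).1 - (z s (γ τ)).1)) =O[𝓝 τ] fun σ => σ - τ :=
      (((V s (γ τ)).2.comp (ContinuousLinearMap.fst ℝ F (F →L[ℝ] ℝ))).isBigO_comp _ _).trans h1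
    refine ((hs τ).isBigO.add (h2.sub h3)).congr_left fun σ => ?_
    ring
  have hIoo : ∀ᵐ s ∂(volume.restrict (Icc a b)), s ∈ Ioo a b := by
    rw [← restrict_Ioo_eq_restrict_Icc]
    exact ae_restrict_mem measurableSet_Ioo
  have hder : ∀ τ, ∀ᵐ s ∂(volume.restrict (Icc a b)),
      deriv (fun s => (z (cl s) (γ τ)).1) s = (V s (γ τ)).1 ∧
      deriv (fun s => (z (cl s) (γ τ)).2) s = (V s (γ τ)).2 := by
    intro τ
    filter_upwards [hV _ (hγ τ), hIoo] with s hs hsI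
    have he : (fun s => z (cl s) (γ τ)) =ᶠ[𝓝 s] fun s => z s (γ τ) := by
      filter_upwards [isOpen_Ioo.mem_nhds hsI] with s' hs'
      rw [hcle s' (Ioo_subset_Icc_self hs')]
    have hd := hs.congr_of_eventuallyEq he
    exact ⟨((ContinuousLinearMap.fst ℝ F (F →L[ℝ] ℝ)).hasFDerivAt.comp_hasDerivAt s hd).deriv,
      ((ContinuousLinearMap.snd ℝ F (F →L[ℝ] ℝ)).hasFDerivAt.comp_hasDerivAt s hd).deriv⟩
  have hgK := integral_sub_eq_actionIntegral_sub hx hp hab (K := fun s τ => K s (γ τ))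
    (g := fun s τ => g s (γ τ)) ?_ hKO ?_ ?_ (fun τ => hgi _ (hγ τ))
  · simp only [γ, clampedSegment_zero, clampedSegment_one] at hgK
    rw [hgK]
    simp only [actionIntegral, hcle a (left_mem_Icc.2 hab), hcle b (right_mem_Icc.2 hab)]
    rfl
  · filter_upwards [hKO] with s hs
    exact continuous_iff_continuousAt.2 fun τ => continuousAt_of_isBigO_sub (hs τ)
  · intro τ
    filter_upwards [hKo, hder τ, ae_restrict_mem measurableSet_Icc] with s hs hd hsI
    rw [hd.1, hd.2]
    simpa only [hcle s hsI] using hs τ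
  · intro τ
    filter_upwards [hder τ, ae_restrict_mem measurableSet_Icc] with s hd hsI
    rw [hd.1, hcle s hsI]
    exact hg _ (hγ τ) s hsI

end LocalFlow

/-! ### The graph of `dα` in coordinates -/

section LagrangianSection

variable {n : ℕ} {M : Type*} [TopologicalSpace M] [ChartedSpace (Model n) M]
  [IsManifold (𝓡 n) ∞ M]

/-- The section `dα` over `V`, as a function of the coordinates of the chart centred at `q`. -/
def lagSection (α : M → ℝ) (V : Set M) (q : M) (u : Model n) : Cotangent n M :=
  dSection α V ((extChartAt (𝓡 n) q).symm u)

/-- The part of `V` in the domain of the chart centred at `q`, in coordinates. -/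
def lagDomain (n : ℕ) {M : Type*} [TopologicalSpace M] [ChartedSpace (Model n) M] (V : Set M)
    (q : M) : Set (Model n) :=
  (extChartAt (𝓡 n) q).target ∩ (extChartAt (𝓡 n) q).symm ⁻¹' V

variable {α : M → ℝ} {V : Set M} {q : M}

omit [IsManifold (𝓡 n) ∞ M] in
theorem isOpen_lagDomain (hV : IsOpen V) : IsOpen (lagDomain n V q) :=
  (continuousOn_extChartAt_symm q).isOpen_inter_preimage (isOpen_extChartAt_target q) hV

omit [IsManifold (𝓡 n) ∞ M] in
theorem extChartAt_self_mem_lagDomain (hq : q ∈ V) :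
    extChartAt (𝓡 n) q q ∈ lagDomain n V q :=
  ⟨mem_extChartAt_target q, by rwa [mem_preimage, extChartAt_to_inv]⟩

omit [IsManifold (𝓡 n) ∞ M] in
theorem symm_mem_chartAt_source {u : Model n} (hu : u ∈ lagDomain n V q) :
    (extChartAt (𝓡 n) q).symm u ∈ (chartAt (Model n) q).source := by
  rw [← extChartAt_source (𝓡 n)]
  exact (extChartAt (𝓡 n) q).map_target hu.1

omit [IsManifold (𝓡 n) ∞ M] in
theorem lagSection_mem {u : Model n} (hu : u ∈ lagDomain n V q) :
    lagSection α V q u ∈ graphOfDifferential (n := n) α V :=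
  mem_image_of_mem _ hu.2

omit [IsManifold (𝓡 n) ∞ M] in
theorem lagSection_extChartAt_self : lagSection α V q (extChartAt (𝓡 n) q q) =
    dSection (n := n) α V q := by
  rw [lagSection, extChartAt_to_inv]

omit [IsManifold (𝓡 n) ∞ M] in
theorem lagSection_extChartAt_proj {ℓ : Cotangent n M} (hℓ : ℓ ∈ graphOfDifferential (n := n) α V)
    (hq : ℓ.proj ∈ (chartAt (Model n) q).source) :
    lagSection α V q (extChartAt (𝓡 n) q ℓ.proj) = ℓ := by
  obtain ⟨y, hy, rfl⟩ := hℓ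
  rw [lagSection, (extChartAt (𝓡 n) q).left_inv (by rw [extChartAt_source]; exact hq)]
  rfl

theorem contDiffOn_comp_extChartAt_symm (hα : ContMDiffOn (𝓡 n) 𝓘(ℝ, ℝ) ∞ α V) :
    ContDiffOn ℝ ∞ (α ∘ (extChartAt (𝓡 n) q).symm) (lagDomain n V q) :=
  (hα.comp ((contMDiffOn_extChartAt_symm q).mono inter_subset_left)
    (fun _ h => h.2)).contDiffOn

/-- The tangent coordinate change entering `covCoord` is the differential of the inverse chart, so
the fibre coordinate follows from the chain rule. -/
theorem cotCoord_lagSection (hV : IsOpen V) (hα : ContMDiffOn (𝓡 n) 𝓘(ℝ, ℝ) ∞ α V)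
    {u : Model n} (hu : u ∈ lagDomain n V q) :
    cotCoord q (lagSection α V q u) = (u, fderiv ℝ (α ∘ (extChartAt (𝓡 n) q).symm) u) := by
  have hy := symm_mem_chartAt_source hu
  refine Prod.ext ((extChartAt (𝓡 n) q).right_inv hu.1) ?_
  change covCoord q (lagSection α V q u) = _
  ext v
  have hr : extChartAt (𝓡 n) q ((extChartAt (𝓡 n) q).symm u) = u :=
    (extChartAt (𝓡 n) q).right_inv hu.1
  have hs : tangentCoordChange (𝓡 n) q ((extChartAt (𝓡 n) q).symm u)
      ((extChartAt (𝓡 n) q).symm u) v =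
      mfderiv 𝓘(ℝ, Model n) (𝓡 n) (extChartAt (𝓡 n) q).symm u v := by
    have := (TangentBundle.symmL_trivializationAt_eq_core (I := 𝓡 n) hy).symm.trans
      (TangentBundle.symmL_trivializationAt (𝕜 := ℝ) hy)
    rw [ModelWithCorners.range_eq_univ, mfderivWithin_univ, hr] at this
    exact DFunLike.congr_fun this v
  refine (covCoord_apply hy v).trans ((congrArg (lagSection α V q u).2 hs).trans ?_)
  have hαd : MDifferentiableAt (𝓡 n) 𝓘(ℝ, ℝ) α ((extChartAt (𝓡 n) q).symm u) :=
    (hα.contMDiffAt (hV.mem_nhds hu.2)).mdifferentiableAt (by simp)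
  have hsd : MDifferentiableAt 𝓘(ℝ, Model n) (𝓡 n) (extChartAt (𝓡 n) q).symm u := by
    have := mdifferentiableWithinAt_extChartAt_symm (I := 𝓡 n) hu.1
    rwa [ModelWithCorners.range_eq_univ, mdifferentiableWithinAt_univ] at this
  have hF : HasMFDerivAt 𝓘(ℝ, Model n) 𝓘(ℝ, ℝ) (α ∘ (extChartAt (𝓡 n) q).symm) u
      ((mfderiv (𝓡 n) 𝓘(ℝ, ℝ) α ((extChartAt (𝓡 n) q).symm u)).comp
        (mfderiv 𝓘(ℝ, Model n) (𝓡 n) (extChartAt (𝓡 n) q).symm u)) :=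
    hαd.hasMFDerivAt.comp u hsd.hasMFDerivAt
  have hc := hF.mfderiv
  rw [mfderiv_eq_fderiv] at hc
  refine Eq.trans ?_ (DFunLike.congr_fun hc v).symm
  change (mfderivWithin (𝓡 n) 𝓘(ℝ, ℝ) α V ((extChartAt (𝓡 n) q).symm u)) _ = _
  rw [mfderivWithin_of_mem_nhds (hV.mem_nhds hu.2)]
  rfl

theorem continuousAt_lagSection (hV : IsOpen V) (hα : ContMDiffOn (𝓡 n) 𝓘(ℝ, ℝ) ∞ α V)
    {u : Model n} (hu : u ∈ lagDomain n V q) : ContinuousAt (lagSection α V q) u := by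
  have ho := (isOpen_lagDomain (n := n) (q := q) hV).mem_nhds hu
  have he : lagSection α V q =ᶠ[𝓝 u]
      fun v => cotCoordSymm q (v, fderiv ℝ (α ∘ (extChartAt (𝓡 n) q).symm) v) := by
    filter_upwards [ho] with v hv
    rw [← cotCoord_lagSection hV hα hv, cotCoordSymm_cotCoord (symm_mem_chartAt_source hv)]
  refine ContinuousAt.congr ?_ he.symm
  have h1 : ContinuousAt (fun v => (v, fderiv ℝ (α ∘ (extChartAt (𝓡 n) q).symm) v)) u :=
    continuousAt_id.prodMk (((contDiffOn_comp_extChartAt_symm hα).contDiffAt ho).continuousAt_fderiv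
      (by simp))
  refine ContinuousAt.comp (g := cotCoordSymm q) ?_ h1
  rw [← cotCoord_lagSection hV hα hu]
  exact (mdifferentiableAt_cotCoordSymm (symm_mem_chartAt_source hu)).continuousAt

end LagrangianSection

/-! ### The flow from the graph of `dα` in coordinates -/

section LocalCoordinates

variable {n : ℕ} {M : Type*} [TopologicalSpace M] [ChartedSpace (Model n) M]
  [IsManifold (𝓡 n) ∞ M] {α : M → ℝ} {V : Set M} {q : M} {J : Set ℝ}
  {Φ : ℝ → Cotangent n M → Cotangent n M}

theorem tendsto_prodMk_lagSection (hV : IsOpen V) (hα : ContMDiffOn (𝓡 n) 𝓘(ℝ, ℝ) ∞ α V)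
    (hJ : IsOpen J) {s : ℝ} (hs : s ∈ J) {u : Model n} (hu : u ∈ lagDomain n V q) :
    Tendsto (fun w : ℝ × Model n => (w.1, lagSection α V q w.2)) (𝓝 (s, u))
      (𝓝[J ×ˢ graphOfDifferential α V] (s, lagSection α V q u)) := by
  refine tendsto_nhdsWithin_iff.2 ⟨?_, ?_⟩
  · exact continuousAt_fst.prodMk
      ((continuousAt_lagSection hV hα hu).comp_of_eq continuousAt_snd rfl)
  · filter_upwards [prod_mem_nhds (hJ.mem_nhds hs) ((isOpen_lagDomain hV).mem_nhds hu)] with w hw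
    exact ⟨hw.1, lagSection_mem hw.2⟩

theorem continuousAt_flow_lagSection (hV : IsOpen V) (hα : ContMDiffOn (𝓡 n) 𝓘(ℝ, ℝ) ∞ α V)
    (hJ : IsOpen J)
    (hΦ : LocLipschitzOn (𝓘(ℝ, ℝ).prod (cotModel n)) (cotModel n)
      (fun z : ℝ × Cotangent n M => Φ z.1 z.2) (J ×ˢ graphOfDifferential α V))
    {s : ℝ} (hs : s ∈ J) {u : Model n} (hu : u ∈ lagDomain n V q) :
    ContinuousAt (fun u => Φ s (lagSection α V q u)) u := by
  have h1 := (hΦ (s, lagSection α V q u) ⟨hs, lagSection_mem hu⟩).1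
  have h2 := tendsto_prodMk_lagSection hV hα hJ hs hu
  exact (h1.tendsto.comp h2).comp (Continuous.prodMk_right s).continuousAt

/-- Near each point, a Lipschitz flow starting on the graph of `dα` is Lipschitz in coordinates. -/
theorem exists_lipschitzOnWith_cotCoord (hV : IsOpen V)
    (hα : ContMDiffOn (𝓡 n) 𝓘(ℝ, ℝ) ∞ α V) (hJ : IsOpen J)
    (hΦ : LocLipschitzOn (𝓘(ℝ, ℝ).prod (cotModel n)) (cotModel n)
      (fun z : ℝ × Cotangent n M => Φ z.1 z.2) (J ×ˢ graphOfDifferential α V))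
    {s₀ : ℝ} (hs₀ : s₀ ∈ J) (hq : q ∈ V) {c : M} (hc : (Φ s₀ (dSection α V q)).proj = c) :
    ∃ δ > 0, ∃ r > 0, ∃ L : ℝ≥0, Metric.ball s₀ δ ⊆ J ∧
      Metric.ball (extChartAt (𝓡 n) q q) r ⊆ lagDomain n V q ∧
      (∀ s ∈ Metric.ball s₀ δ, ∀ u ∈ Metric.ball (extChartAt (𝓡 n) q q) r,
        (Φ s (lagSection α V q u)).proj ∈ (chartAt (Model n) c).source) ∧
      LipschitzOnWith L (Function.uncurry fun s u => cotCoord c (Φ s (lagSection α V q u)))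
        (Metric.ball s₀ δ ×ˢ Metric.ball (extChartAt (𝓡 n) q q) r) := by
  set u₀ := extChartAt (𝓡 n) q q
  have hu₀ : u₀ ∈ lagDomain n V q := extChartAt_self_mem_lagDomain hq
  have hψ₀ : lagSection α V q u₀ = dSection α V q := lagSection_extChartAt_self
  obtain ⟨hcont, U, hU, C, hC⟩ := hΦ (s₀, dSection α V q) ⟨hs₀, mem_image_of_mem _ hq⟩
  have ht := tendsto_prodMk_lagSection hV hα hJ hs₀ hu₀
  rw [hψ₀] at ht
  have hsrc : ∀ᶠ w in 𝓝 (s₀, u₀),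
      (Φ w.1 (lagSection α V q w.2)).proj ∈ (chartAt (Model n) c).source :=
    (hcont.tendsto.comp ht).eventually
      (eventually_mem_chartAt_source (c := c) (by rw [hc]; exact mem_chart_source _ _))
  have hdom := prod_mem_nhds (hJ.mem_nhds hs₀) ((isOpen_lagDomain hV).mem_nhds hu₀)
  -- Distances on the graph are measured in `T*M`; they are comparable to base distances because
  -- `dα` is locally Lipschitz. This gives the factor `max 1 K` below.
  have hcd : ContDiffAt ℝ 1 (fderiv ℝ (α ∘ (extChartAt (𝓡 n) q).symm)) u₀ :=
    ((contDiffOn_comp_extChartAt_symm hα).contDiffAt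
      ((isOpen_lagDomain hV).mem_nhds hu₀)).fderiv_right (WithTop.coe_le_coe.2 le_top)
  obtain ⟨K, W, hW, hKW⟩ := hcd.exists_lipschitzOnWith
  have hall := (((ht.eventually hU).and hsrc).and hdom).and
    ((continuousAt_snd (p := (s₀, u₀))).eventually_mem hW)
  obtain ⟨ε, hε, hball⟩ := Metric.eventually_nhds_iff_ball.1 hall
  have hb : ∀ s ∈ Metric.ball s₀ ε, ∀ u ∈ Metric.ball u₀ ε, (s, u) ∈ Metric.ball (s₀, u₀) ε :=
    fun s hs u hu => by rw [← ball_prod_same]; exact ⟨hs, hu⟩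
  refine ⟨ε, hε, ε, hε, C * max 1 K,
    fun s hs => (hball _ (hb s hs u₀ (Metric.mem_ball_self hε))).1.2.1,
    fun u hu => (hball _ (hb s₀ (Metric.mem_ball_self hε) u hu)).1.2.2,
    fun s hs u hu => (hball _ (hb s hs u hu)).1.1.2, ?_⟩
  refine LipschitzOnWith.of_dist_le_mul ?_
  rintro ⟨s, u⟩ ⟨hs, hu⟩ ⟨s', u'⟩ ⟨hs', hu'⟩
  have b1 := hball _ (hb s hs u hu)
  have b2 := hball _ (hb s' hs' u' hu')
  have h1 := hC _ b1.1.1.1 _ b2.1.1.1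
  simp only [extChartAt_prod, PartialEquiv.prod_coe, coe_extChartAt_cotModel, hc,
    extChartAt_model_space_eq_id, PartialEquiv.refl_coe, id] at h1
  have e : (dSection α V q : Cotangent n M).proj = q := rfl
  rw [e, cotCoord_lagSection hV hα b1.1.2.2, cotCoord_lagSection hV hα b2.1.2.2] at h1
  refine h1.trans ?_
  have h2 := hKW.dist_le_mul _ b1.2 _ b2.2
  push_cast
  rw [mul_assoc]
  refine mul_le_mul_of_nonneg_left ?_ C.coe_nonneg
  simp only [Prod.dist_eq]
  have hm : (0 : ℝ) ≤ max 1 (K : ℝ) := zero_le_one.trans (le_max_left _ _)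
  have hn : (0 : ℝ) ≤ max (dist s s') (dist u u') := dist_nonneg.trans (le_max_left _ _)
  have h3 : max (dist s s') (dist u u') ≤ max 1 (K : ℝ) * max (dist s s') (dist u u') :=
    le_mul_of_one_le_left hn (le_max_left _ _)
  refine max_le ((le_max_left _ _).trans h3) (max_le ((le_max_right _ _).trans h3) ?_)
  exact h2.trans (mul_le_mul (le_max_right _ _) (le_max_right _ _) dist_nonneg hm)

end LocalCoordinates

/-! ### The identity `dθ_s = Φ_s^* ς` and its propagation in time -/

section Primitives

variable {n : ℕ} {M : Type*} [TopologicalSpace M] [ChartedSpace (Model n) M]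
  [IsManifold (𝓡 n) ∞ M]

/-- `df = k^* (p dx)` at `u`, for the coordinates `(x, p)` of `T*M` over the chart centred at `c`. -/
def IsPrimitiveAt (f : Model n → ℝ) (k : Model n → Cotangent n M) (u : Model n) (c : M) : Prop :=
  (fun v => f v - f u - covCoord c (k u)
    (extChartAt (𝓡 n) c (k v).proj - extChartAt (𝓡 n) c (k u).proj)) =o[𝓝 u] fun v => v - u

/-- The form `p dx` does not depend on the chart. -/
theorem IsPrimitiveAt.change {f : Model n → ℝ} {k : Model n → Cotangent n M} {u : Model n}
    {c c' : M} (hf : IsPrimitiveAt f k u c) (hk : ContinuousAt k u)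
    (hO : (fun v => extChartAt (𝓡 n) c (k v).proj - extChartAt (𝓡 n) c (k u).proj) =O[𝓝 u]
      fun v => v - u)
    (hc : (k u).proj ∈ (chartAt (Model n) c).source)
    (hc' : (k u).proj ∈ (chartAt (Model n) c').source) : IsPrimitiveAt f k u c' := by
  have hT : HasFDerivAt (chartChange n c c') (tangentCoordChange (𝓡 n) c c' (k u).proj)
      (extChartAt (𝓡 n) c (k u).proj) := by
    rw [← fderiv_chartChange]
    exact ((contDiffAt_chartChange hc hc').differentiableAt (by simp)).hasFDerivAt
  have hev := hk.eventually (eventually_mem_chartAt_source hc)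
  have hx0 : ContinuousAt (fun v => extChartAt (𝓡 n) c (k v).proj) u :=
    continuousAt_of_isBigO_sub (f := fun v => extChartAt (𝓡 n) c (k v).proj) hO
  -- The error of linearizing the chart change is `o(|x(v) - x(u)|)`, hence `o(|v - u|)`; the
  -- transformation law of covectors absorbs the linear part.
  have h1 := ((hasFDerivAt_iff_isLittleO.1 hT).comp_tendsto hx0).trans_isBigO hO
  have h2 := ((covCoord c' (k u)).isBigO_comp _ _).trans_isLittleO h1
  refine (hf.sub h2).congr' ?_ EventuallyEq.rfl
  filter_upwards [hev] with v hv
  simp only [Function.comp_apply, map_sub]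
  rw [chartChange_extChartAt c' hv, chartChange_extChartAt c' hc]
  simp only [← covCoord_apply_eq hc hc']
  ring

variable {J : Set ℝ} {V : Set M} {α : M → ℝ} {O : Set (Cotangent n M)}
  {H : ℝ → Cotangent n M → ℝ} {Φ : ℝ → Cotangent n M → Cotangent n M} {q : M}

theorem intervalIntegrable_cartanIntegrand {Λ : Set (Cotangent n M)} (hJi : J.OrdConnected)
    (hΦ : RegularHamiltonianFlow J O Λ H Φ) {a b : ℝ} (ha : a ∈ J) (hb : b ∈ J)
    {ℓ : Cotangent n M} (hℓ : ℓ ∈ Λ) :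
    IntervalIntegrable (fun s => cartanIntegrand H Φ s ℓ) volume a b := by
  rw [intervalIntegrable_iff']
  have : IsFiniteMeasure (volume.restrict (uIcc a b)) := by unfold uIcc; infer_instance
  have h := (hΦ.caratheodory.bounded_measurable ℓ hℓ).mono_measure
    (Measure.restrict_mono (hJi.uIcc_subset ha hb) le_rfl)
  exact h.integrable le_top

/-- Cartan's formula in coordinates: the increments of `θ_s` and the integrals of `p dx` along the
images of segments change by the same amounts in time. -/
theorem theta_sub_sub_eq_segmentAction_sub (hV : IsOpen V)
    (hα : ContMDiffOn (𝓡 n) 𝓘(ℝ, ℝ) ∞ α V) (hJ : IsOpen J) (hJi : J.OrdConnected)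
    (hJ0 : (0 : ℝ) ∈ J) (hΦ : RegularHamiltonianFlow J O (graphOfDifferential α V) H Φ)
    {a b : ℝ} (hab : a ≤ b) (ha : a ∈ J) (hb : b ∈ J) {S : Set (Model n)} (hS : Convex ℝ S)
    (hSo : IsOpen S) (hSd : S ⊆ lagDomain n V q) {c : M}
    (hc : ∀ s ∈ Icc a b, ∀ u ∈ S, (Φ s (lagSection α V q u)).proj ∈ (chartAt (Model n) c).source)
    {L : ℝ≥0} (hL : LipschitzOnWith L
      (Function.uncurry fun s u => cotCoord c (Φ s (lagSection α V q u))) (Icc a b ×ˢ S))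
    {u v : Model n} (hu : u ∈ S) (hv : v ∈ S) :
    (theta α H Φ b (lagSection α V q v) - theta α H Φ b (lagSection α V q u)) -
      (theta α H Φ a (lagSection α V q v) - theta α H Φ a (lagSection α V q u)) =
    segmentAction (fun u => cotCoord c (Φ b (lagSection α V q u))) u v -
      segmentAction (fun u => cotCoord c (Φ a (lagSection α V q u))) u v := by
  have hI : Icc a b ⊆ J := hJi.out ha hb
  have hmem : ∀ w ∈ S, lagSection α V q w ∈ graphOfDifferential (n := n) α V :=
    fun w hw => lagSection_mem (hSd hw)
  have hint : ∀ w ∈ S, ∀ a ∈ J, ∀ b ∈ J,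
      IntervalIntegrable (fun s => cartanIntegrand H Φ s (lagSection α V q w)) volume a b :=
    fun w hw a ha b hb => intervalIntegrable_cartanIntegrand hJi hΦ ha hb (hmem w hw)
  have hkey := integral_sub_eq_segmentAction_sub (a := a) (b := b) (S := S)
    (z := fun s u => cotCoord c (Φ s (lagSection α V q u)))
    (V := fun s u => dCot c (Φ s (lagSection α V q u))
      (hamiltonianField (H s) (Φ s (lagSection α V q u))))
    (K := fun s u => H s (Φ s (lagSection α V q u)))
    (g := fun s u => cartanIntegrand H Φ s (lagSection α V q u))
    hab hS hSo hL ?_ ?_ ?_ ?_ hu hv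
  · rw [← hkey, intervalIntegral.integral_sub (hint v hv a ha b hb) (hint u hu a ha b hb)]
    simp only [theta]
    rw [← intervalIntegral.integral_interval_sub_left (hint v hv 0 hJ0 b hb) (hint v hv 0 hJ0 a ha),
      ← intervalIntegral.integral_interval_sub_left (hint u hu 0 hJ0 b hb) (hint u hu 0 hJ0 a ha)]
    ring
  · filter_upwards [ae_restrict_of_ae_restrict_of_subset hI hΦ.differentiable,
      ae_restrict_mem measurableSet_Icc] with s hs hsI w hw
    exact (hamiltonian_sub_isLittleO (hc s hsI w hw)
      (hs _ (hΦ.flow.mem s (hI hsI) _ (hmem w hw)))).comp_tendsto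
      (continuousAt_flow_lagSection hV hα hJ hΦ.lipschitz (hI hsI) (hSd hw))
  · intro w hw
    filter_upwards [ae_restrict_of_ae_restrict_of_subset hI (hΦ.flow.hasDeriv _ (hmem w hw)),
      ae_restrict_mem measurableSet_Icc] with s hs hsI
    exact hasDerivAt_cotCoord (hc s hsI w hw) hs
  · intro w hw s hsI
    rw [cartanIntegrand, liouvilleForm_eq_dCot (hc s hsI w hw)]
    rfl
  · intro w hw
    rw [← intervalIntegrable_iff_integrableOn_Icc_of_le hab]
    exact hint w hw a ha b hb

/-- Near the base point of the chart, `dθ_s = Φ_s^* (p dx)` on the graph of `dα`. -/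
def ThetaIsPrimitive (α : M → ℝ) (V : Set M) (H : ℝ → Cotangent n M → ℝ)
    (Φ : ℝ → Cotangent n M → Cotangent n M) (q : M) (s : ℝ) : Prop :=
  ∀ᶠ u in 𝓝 (extChartAt (𝓡 n) q q), ∀ c,
    (Φ s (lagSection α V q u)).proj ∈ (chartAt (Model n) c).source →
      IsPrimitiveAt (fun u => theta α H Φ s (lagSection α V q u))
        (fun u => Φ s (lagSection α V q u)) u c

/-- At time zero `x(u) = u` and `p(u)` is the derivative of `α` in the chart at `q`, so the claim
there is differentiability of `α`; other charts follow by invariance of `p dx`. -/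
theorem thetaIsPrimitive_zero (hV : IsOpen V) (hα : ContMDiffOn (𝓡 n) 𝓘(ℝ, ℝ) ∞ α V)
    (hΦ0 : ∀ ℓ ∈ graphOfDifferential (n := n) α V, Φ 0 ℓ = ℓ) (hq : q ∈ V) :
    ThetaIsPrimitive α V H Φ q 0 := by
  have ho := isOpen_lagDomain (n := n) (q := q) hV
  filter_upwards [ho.mem_nhds (extChartAt_self_mem_lagDomain hq)] with u hu c hc
  have he : (fun u => Φ 0 (lagSection α V q u)) =ᶠ[𝓝 u] lagSection α V q := by
    filter_upwards [ho.mem_nhds hu] with v hv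
    exact hΦ0 _ (lagSection_mem hv)
  have hx : ∀ v ∈ lagDomain n V q,
      extChartAt (𝓡 n) q (Φ 0 (lagSection α V q v)).proj = v := fun v hv => by
    rw [hΦ0 _ (lagSection_mem hv)]
    exact congrArg Prod.fst (cotCoord_lagSection hV hα hv)
  have hd := ((contDiffOn_comp_extChartAt_symm (q := q) hα).contDiffAt
    (ho.mem_nhds hu)).differentiableAt (by simp)
  have hp : covCoord q (Φ 0 (lagSection α V q u)) =
      fderiv ℝ (α ∘ (extChartAt (𝓡 n) q).symm) u := by
    rw [hΦ0 _ (lagSection_mem hu)]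
    exact congrArg Prod.snd (cotCoord_lagSection hV hα hu)
  have hsrc : (Φ 0 (lagSection α V q u)).proj ∈ (chartAt (Model n) q).source := by
    rw [hΦ0 _ (lagSection_mem hu)]
    exact symm_mem_chartAt_source hu
  refine IsPrimitiveAt.change (c := q) ?_
    ((continuousAt_lagSection hV hα hu).congr he.symm) ?_ hsrc hc
  · refine (hasFDerivAt_iff_isLittleO.1 hd.hasFDerivAt).congr' ?_ EventuallyEq.rfl
    filter_upwards [ho.mem_nhds hu] with v hv
    rw [hx v hv, hx u hu, hp]
    simp only [theta, intervalIntegral.integral_same, add_zero]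
    rfl
  · refine (Asymptotics.isBigO_refl (fun v => v - u) (𝓝 u)).congr' ?_ EventuallyEq.rfl
    filter_upwards [ho.mem_nhds hu] with v hv
    rw [hx v hv, hx u hu]

/-- The property `ThetaIsPrimitive` propagates locally in time. -/
theorem eventually_thetaIsPrimitive_iff (hV : IsOpen V)
    (hα : ContMDiffOn (𝓡 n) 𝓘(ℝ, ℝ) ∞ α V) (hJ : IsOpen J) (hJi : J.OrdConnected)
    (hJ0 : (0 : ℝ) ∈ J) (hΦ : RegularHamiltonianFlow J O (graphOfDifferential α V) H Φ)
    (hq : q ∈ V) {s₀ : ℝ} (hs₀ : s₀ ∈ J) :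
    ∀ᶠ s in 𝓝 s₀, ThetaIsPrimitive α V H Φ q s₀ ↔ ThetaIsPrimitive α V H Φ q s := by
  obtain ⟨δ, hδ, r, hr, L, hδJ, hrd, hsrc, hL⟩ :=
    exists_lipschitzOnWith_cotCoord hV hα hJ hΦ.lipschitz hs₀ hq rfl
  set c := (Φ s₀ (dSection α V q)).proj
  set u₀ := extChartAt (𝓡 n) q q
  -- Integrate the identity at `s₁` along segments, transport it by the conservation law, and
  -- differentiate at `s₂`. The ball in space may depend on `s₁`, as only germs at `q` matter;
  -- working in both time directions makes the property locally constant.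
  have step : ∀ s₁ ∈ Metric.ball s₀ δ, ∀ s₂ ∈ Metric.ball s₀ δ,
      ThetaIsPrimitive α V H Φ q s₁ → ThetaIsPrimitive α V H Φ q s₂ := by
    intro s₁ h₁ s₂ h₂ hP
    obtain ⟨ρ, hρ, hPρ⟩ := Metric.eventually_nhds_iff_ball.1 hP
    set S := Metric.ball u₀ (min r ρ)
    have hSr : S ⊆ Metric.ball u₀ r := Metric.ball_subset_ball (min_le_left _ _)
    have hSρ : S ⊆ Metric.ball u₀ ρ := Metric.ball_subset_ball (min_le_right _ _)
    have hSc : Convex ℝ S := convex_ball _ _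
    have hSo : IsOpen S := Metric.isOpen_ball
    have hLs : ∀ s ∈ Metric.ball s₀ δ,
        LipschitzOnWith L (fun u => cotCoord c (Φ s (lagSection α V q u))) S := by
      intro s hs
      refine LipschitzOnWith.of_dist_le_mul fun v hv v' hv' => ?_
      simpa [Prod.dist_eq, Function.uncurry] using
        hL.dist_le_mul (s, v) ⟨hs, hSr hv⟩ (s, v') ⟨hs, hSr hv'⟩
    have hdiff : ∀ a ∈ Metric.ball s₀ δ, ∀ b ∈ Metric.ball s₀ δ, a ≤ b → ∀ u ∈ S, ∀ v ∈ S,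
        (theta α H Φ b (lagSection α V q v) - theta α H Φ b (lagSection α V q u)) -
          (theta α H Φ a (lagSection α V q v) - theta α H Φ a (lagSection α V q u)) =
        segmentAction (fun u => cotCoord c (Φ b (lagSection α V q u))) u v -
          segmentAction (fun u => cotCoord c (Φ a (lagSection α V q u))) u v := by
      intro a ha b hb hab u hu v hv
      have hI : Icc a b ⊆ Metric.ball s₀ δ := (convex_ball s₀ δ).ordConnected.out ha hb
      exact theta_sub_sub_eq_segmentAction_sub hV hα hJ hJi hJ0 hΦ hab (hδJ ha) (hδJ hb) hSc hSo
        (hSr.trans hrd) (fun s hs u hu => hsrc s (hI hs) u (hSr hu))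
        (hL.mono (prod_mono hI hSr)) hu hv
    have h1 : ∀ u ∈ S, ∀ v ∈ S,
        theta α H Φ s₁ (lagSection α V q v) - theta α H Φ s₁ (lagSection α V q u) =
          segmentAction (fun u => cotCoord c (Φ s₁ (lagSection α V q u))) u v := by
      intro u hu v hv
      exact sub_eq_segmentAction hSc hSo (hLs s₁ h₁)
        (fun w hw => hPρ w (hSρ hw) c (hsrc s₁ h₁ w (hSr hw))) hu hv
    have h2 : ∀ u ∈ S, ∀ v ∈ S,
        theta α H Φ s₂ (lagSection α V q v) - theta α H Φ s₂ (lagSection α V q u) =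
          segmentAction (fun u => cotCoord c (Φ s₂ (lagSection α V q u))) u v := by
      intro u hu v hv
      have e1 := h1 u hu v hv
      rcases le_total s₁ s₂ with h | h
      · linarith [hdiff s₁ h₁ s₂ h₂ h u hu v hv]
      · linarith [hdiff s₂ h₂ s₁ h₁ h u hu v hv]
    filter_upwards [Metric.ball_mem_nhds u₀ (lt_min hr hρ)] with u hu c' hc'
    have hO := (hLs s₂ h₂).isBigO_sub_nhds (hSo.mem_nhds hu)
    refine IsPrimitiveAt.change (c := c)
      (isLittleO_of_sub_eq_segmentAction hSc hSo (hLs s₂ h₂) h2 hu)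
      (continuousAt_flow_lagSection hV hα hJ hΦ.lipschitz (hδJ h₂) (hrd (hSr hu))) ?_
      (hsrc s₂ h₂ u (hSr hu)) hc'
    exact ((ContinuousLinearMap.fst ℝ (Model n) (Model n →L[ℝ] ℝ)).isBigO_comp _ _).trans hO
  filter_upwards [Metric.ball_mem_nhds s₀ hδ] with s hs
  exact ⟨step s₀ (Metric.mem_ball_self hδ) s hs, step s hs s₀ (Metric.mem_ball_self hδ)⟩

/-- A locally constant property on the connected interval `J` that holds at time zero holds
throughout. -/
theorem thetaIsPrimitive (hV : IsOpen V) (hα : ContMDiffOn (𝓡 n) 𝓘(ℝ, ℝ) ∞ α V)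
    (hJ : IsOpen J) (hJi : J.OrdConnected) (hJ0 : (0 : ℝ) ∈ J)
    (hΦ : RegularHamiltonianFlow J O (graphOfDifferential α V) H Φ) (hq : q ∈ V) {t : ℝ}
    (ht : t ∈ J) : ThetaIsPrimitive α V H Φ q t := by
  have h0 : ThetaIsPrimitive α V H Φ q 0 := thetaIsPrimitive_zero hV hα hΦ.flow.initial hq
  refine (hJi.isPreconnected.induction₂
    (fun s s' => ThetaIsPrimitive α V H Φ q s ↔ ThetaIsPrimitive α V H Φ q s')
    (fun s hs => ?_) (fun _ _ _ _ _ _ h h' => h.trans h') (fun _ _ _ _ h => h.symm)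
    hJ0 ht).1 h0
  exact (eventually_thetaIsPrimitive_iff hV hα hJ hJi hJ0 hΦ hq hs).filter_mono nhdsWithin_le_nhds

end Primitives

/-! ### The function `α_t` and its differential on the projected image -/

section Generating

variable {n : ℕ} {M : Type*} [TopologicalSpace M] [ChartedSpace (Model n) M]
  [IsManifold (𝓡 n) ∞ M] {J : Set ℝ} {V : Set M} {α : M → ℝ} {O : Set (Cotangent n M)}
  {H : ℝ → Cotangent n M → ℝ} {Φ : ℝ → Cotangent n M → Cotangent n M} {t : ℝ} {x : M}

/-- The inverse of the projected flow on `Λ`. -/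
abbrev projFlowInv [Nonempty M] (Φ : ℝ → Cotangent n M → Cotangent n M) (Λ : Set (Cotangent n M))
    (t : ℝ) (x : M) : Cotangent n M :=
  Function.invFunOn (projFlow Φ t) Λ x

omit [IsManifold (𝓡 n) ∞ M] in
theorem projFlowInv_mem [Nonempty M] {Λ : Set (Cotangent n M)} (hx : x ∈ projFlow Φ t '' Λ) :
    projFlowInv Φ Λ t x ∈ Λ := Function.invFunOn_mem hx

omit [IsManifold (𝓡 n) ∞ M] in
theorem projFlow_projFlowInv [Nonempty M] {Λ : Set (Cotangent n M)} (hx : x ∈ projFlow Φ t '' Λ) :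
    (Φ t (projFlowInv Φ Λ t x)).proj = x := Function.invFunOn_eq hx

theorem continuousWithinAt_flow_projFlowInv [Nonempty M] {Λ : Set (Cotangent n M)}
    (hΦ : RegularHamiltonianFlow J O Λ H Φ) (ht : t ∈ J)
    (hbi : IsBiLipschitzOn (cotModel n) (𝓡 n) (projFlow Φ t) Λ) (hx : x ∈ projFlow Φ t '' Λ) :
    ContinuousWithinAt (fun y => Φ t (projFlowInv Φ Λ t y)) (projFlow Φ t '' Λ) x := by
  have h1 := (hbi.lipschitz_inv x hx).1
  have h2 := (hΦ.lipschitz (t, projFlowInv Φ Λ t x) ⟨ht, projFlowInv_mem hx⟩).1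
  exact h2.comp (f := fun y => (t, projFlowInv Φ Λ t y)) (continuousWithinAt_const.prodMk h1)
    fun y hy => ⟨ht, projFlowInv_mem hy⟩

/-- The first-order expansion of `α_t` in the chart centred at `x`, at all points near `x`. -/
theorem eventually_alphaT_sub_isLittleO [Nonempty M] (hV : IsOpen V)
    (hα : ContMDiffOn (𝓡 n) 𝓘(ℝ, ℝ) ∞ α V) (hJ : IsOpen J) (hJi : J.OrdConnected)
    (hJ0 : (0 : ℝ) ∈ J) (hΦ : RegularHamiltonianFlow J O (graphOfDifferential α V) H Φ)
    (ht : t ∈ J)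
    (hbi : IsBiLipschitzOn (cotModel n) (𝓡 n) (projFlow Φ t) (graphOfDifferential α V))
    (hx : x ∈ projFlow Φ t '' graphOfDifferential α V) :
    ∀ᶠ y in 𝓝[projFlow Φ t '' graphOfDifferential α V] x,
      (fun y' => alphaT α H Φ (graphOfDifferential α V) t y' -
          alphaT α H Φ (graphOfDifferential α V) t y -
          covCoord x (Φ t (projFlowInv Φ (graphOfDifferential α V) t y))
            (extChartAt (𝓡 n) x y' - extChartAt (𝓡 n) x y))
        =o[𝓝[projFlow Φ t '' graphOfDifferential α V] y]
          fun y' => extChartAt (𝓡 n) x y' - extChartAt (𝓡 n) x y := by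
  set Λ : Set (Cotangent n M) := graphOfDifferential α V
  set S := projFlow Φ t '' Λ
  obtain ⟨q, hq, hqx⟩ : projFlowInv Φ Λ t x ∈ dSection α V '' V := projFlowInv_mem hx
  have hqp : (projFlowInv Φ Λ t x).proj = q := by rw [← hqx]; rfl
  obtain ⟨hcont, U, hU, C, hC⟩ := hbi.lipschitz_inv x hx
  rw [coe_extChartAt_cotModel, hqp] at hC
  have hsrc : ∀ᶠ y in 𝓝[S] x, (projFlowInv Φ Λ t y).proj ∈ (chartAt (Model n) q).source :=
    hcont.eventually (eventually_mem_chartAt_source (by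
      change (projFlowInv Φ Λ t x).proj ∈ _
      rw [hqp]; exact mem_chart_source _ _))
  have hw : ∀ y ∈ S, (projFlowInv Φ Λ t y).proj ∈ (chartAt (Model n) q).source →
      ContinuousWithinAt (fun y => extChartAt (𝓡 n) q (projFlowInv Φ Λ t y).proj) S y :=
    fun y hy hys => continuousAt_fst.comp_continuousWithinAt
      ((continuousAt_cotCoord hys).comp_continuousWithinAt (hbi.lipschitz_inv y hy).1)
  have hwx := hw x hx (hsrc.self_of_nhdsWithin hx)
  have hP : ∀ᶠ y in 𝓝[S] x, ∀ c,
      (Φ t (lagSection α V q (extChartAt (𝓡 n) q (projFlowInv Φ Λ t y).proj))).proj ∈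
        (chartAt (Model n) c).source →
      IsPrimitiveAt (fun u => theta α H Φ t (lagSection α V q u))
        (fun u => Φ t (lagSection α V q u))
        (extChartAt (𝓡 n) q (projFlowInv Φ Λ t y).proj) c := by
    have h := hwx.tendsto
    rw [hqp] at h
    exact h.eventually (thetaIsPrimitive hV hα hJ hJi hJ0 hΦ hq ht)
  -- The expansion is needed at all nearby points in one fixed chart, since class `C^1` is to be
  -- read off from it.
  have hev : ∀ᶠ y in 𝓝[S] x, ∀ᶠ y' in 𝓝[S] y, y' ∈ U ∧ y' ∈ S ∧
      (projFlowInv Φ Λ t y').proj ∈ (chartAt (Model n) q).source ∧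
      lagSection α V q (extChartAt (𝓡 n) q (projFlowInv Φ Λ t y').proj) =
        projFlowInv Φ Λ t y' := by
    rw [eventually_eventually_nhdsWithin]
    filter_upwards [hU, self_mem_nhdsWithin, hsrc] with y h1 h2 h3
    exact ⟨h1, h2, h3, lagSection_extChartAt_proj (projFlowInv_mem h2) h3⟩
  filter_upwards [hP, hev, self_mem_nhdsWithin,
    mem_nhdsWithin_of_mem_nhds ((chartAt (Model n) x).open_source.mem_nhds
      (mem_chart_source _ x))] with y hPy hevy hyS hyx
  obtain ⟨hyU, -, hysrc, hψy⟩ := hevy.self_of_nhdsWithin hyS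
  have h1 := hPy x (by rwa [hψy, projFlow_projFlowInv hyS])
  have h2 := h1.comp_tendsto (hw y hyS hysrc)
  -- Here the Lipschitz inverse is essential: it turns an error that is small relative to increments
  -- in `Λ` into one small relative to increments in the image.
  have h3 : (fun y' => extChartAt (𝓡 n) q (projFlowInv Φ Λ t y').proj -
      extChartAt (𝓡 n) q (projFlowInv Φ Λ t y).proj) =O[𝓝[S] y]
      fun y' => extChartAt (𝓡 n) x y' - extChartAt (𝓡 n) x y := by
    refine Asymptotics.IsBigO.of_bound C ?_
    filter_upwards [hevy] with y' hy'
    rw [← dist_eq_norm, ← dist_eq_norm]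
    exact (le_max_left _ _).trans (hC y' hy'.1 y hyU)
  refine (h2.trans_isBigO h3).congr' ?_ EventuallyEq.rfl
  filter_upwards [hevy] with y' hy'
  simp only [Function.comp_apply]
  rw [hy'.2.2.2, hψy, projFlow_projFlowInv hyS, projFlow_projFlowInv hy'.2.1]
  rfl

/-- The differential of `α_t` in the chart centred at `x`, at all points near `x`. -/
theorem eventually_hasFDerivWithinAt_alphaT [Nonempty M] (hV : IsOpen V)
    (hα : ContMDiffOn (𝓡 n) 𝓘(ℝ, ℝ) ∞ α V) (hJ : IsOpen J) (hJi : J.OrdConnected)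
    (hJ0 : (0 : ℝ) ∈ J) (hΦ : RegularHamiltonianFlow J O (graphOfDifferential α V) H Φ)
    (ht : t ∈ J)
    (hbi : IsBiLipschitzOn (cotModel n) (𝓡 n) (projFlow Φ t) (graphOfDifferential α V))
    (hx : x ∈ projFlow Φ t '' graphOfDifferential α V) :
    ∀ᶠ u in 𝓝[(extChartAt (𝓡 n) x).symm ⁻¹' (projFlow Φ t '' graphOfDifferential α V)]
        (extChartAt (𝓡 n) x x),
      HasFDerivWithinAt
        (alphaT α H Φ (graphOfDifferential α V) t ∘ (extChartAt (𝓡 n) x).symm)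
        (covCoord x (Φ t (projFlowInv Φ (graphOfDifferential α V) t
          ((extChartAt (𝓡 n) x).symm u))))
        ((extChartAt (𝓡 n) x).symm ⁻¹' (projFlow Φ t '' graphOfDifferential α V)) u := by
  have hsymm : ∀ u ∈ (extChartAt (𝓡 n) x).target, ∀ S : Set M,
      Tendsto (extChartAt (𝓡 n) x).symm (𝓝[(extChartAt (𝓡 n) x).symm ⁻¹' S] u)
        (𝓝[S] (extChartAt (𝓡 n) x).symm u) := fun u hu S =>
    (continuousAt_extChartAt_symm'' hu).continuousWithinAt.tendsto_nhdsWithin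
      (mapsTo_preimage _ _)
  have htgt := isOpen_extChartAt_target (I := 𝓡 n) x
  have h := eventually_alphaT_sub_isLittleO hV hα hJ hJi hJ0 hΦ ht hbi hx
  have hx' := hsymm _ (mem_extChartAt_target x) (projFlow Φ t '' graphOfDifferential α V)
  rw [extChartAt_to_inv] at hx'
  filter_upwards [hx'.eventually h,
    mem_nhdsWithin_of_mem_nhds (htgt.mem_nhds (mem_extChartAt_target x))] with u hu hut
  have h1 := hu.comp_tendsto (hsymm u hut _)
  rw [hasFDerivWithinAt_iff_isLittleO]
  have hr : ∀ᶠ v in 𝓝[(extChartAt (𝓡 n) x).symm ⁻¹'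
      (projFlow Φ t '' graphOfDifferential α V)] u,
      extChartAt (𝓡 n) x ((extChartAt (𝓡 n) x).symm v) = v := by
    filter_upwards [mem_nhdsWithin_of_mem_nhds (htgt.mem_nhds hut)] with v hv
    exact (extChartAt (𝓡 n) x).right_inv hv
  have hru := (extChartAt (𝓡 n) x).right_inv hut
  refine h1.congr' ?_ ?_
  · filter_upwards [hr] with v hv
    simp only [Function.comp_apply, hv, hru]
  · filter_upwards [hr] with v hv
    simp only [Function.comp_apply, hv, hru]

/-- The image of a bi-Lipschitz projected flow has unique differentials. -/
theorem uniqueMDiffWithinAt_image_projFlow [Nonempty M] (hV : IsOpen V)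
    (hα : ContMDiffOn (𝓡 n) 𝓘(ℝ, ℝ) ∞ α V) (hJ : IsOpen J)
    (hΦ : RegularHamiltonianFlow J O (graphOfDifferential α V) H Φ) (ht : t ∈ J)
    (hbi : IsBiLipschitzOn (cotModel n) (𝓡 n) (projFlow Φ t) (graphOfDifferential α V))
    (hx : x ∈ projFlow Φ t '' graphOfDifferential α V) :
    UniqueMDiffWithinAt (𝓡 n) (projFlow Φ t '' graphOfDifferential α V) x := by
  set Λ : Set (Cotangent n M) := graphOfDifferential α V
  set S := projFlow Φ t '' Λ
  obtain ⟨q, hq, hqx⟩ : projFlowInv Φ Λ t x ∈ dSection α V '' V := projFlowInv_mem hx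
  have hqp : (projFlowInv Φ Λ t x).proj = q := by rw [← hqx]; rfl
  have hΦq : (Φ t (dSection α V q)).proj = x := by rw [hqx]; exact projFlow_projFlowInv hx
  obtain ⟨-, U, hU, C, hC⟩ := hbi.lipschitz_inv x hx
  rw [coe_extChartAt_cotModel, hqp] at hC
  obtain ⟨δ, hδ, r, hr, L, hδJ, hrd, hsrc, hL⟩ :=
    exists_lipschitzOnWith_cotCoord hV hα hJ hΦ.lipschitz ht hq hΦq
  have htδ := Metric.mem_ball_self (x := t) hδ
  set u₀ := extChartAt (𝓡 n) q q
  have hu₀ : u₀ ∈ lagDomain n V q := extChartAt_self_mem_lagDomain hq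
  have hu₀x : projFlow Φ t (lagSection α V q u₀) = x := by
    rw [lagSection_extChartAt_self]; exact hΦq
  have hT : ∀ᶠ u in 𝓝 u₀, projFlow Φ t (lagSection α V q u) ∈ U := by
    have h1 : ContinuousAt (fun u => projFlow Φ t (lagSection α V q u)) u₀ :=
      (FiberBundle.continuous_proj (Model n →L[ℝ] ℝ)
        (fun x : M => TangentSpace (𝓡 n) x →L[ℝ] Bundle.Trivial M ℝ x)).continuousAt.comp
        (continuousAt_flow_lagSection hV hα hJ hΦ.lipschitz ht hu₀)
    have h2 : Tendsto (fun u => projFlow Φ t (lagSection α V q u)) (𝓝 u₀) (𝓝[S] x) := by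
      refine tendsto_nhdsWithin_iff.2 ⟨hu₀x ▸ h1, ?_⟩
      filter_upwards [(isOpen_lagDomain hV).mem_nhds hu₀] with u hu
      exact mem_image_of_mem _ (lagSection_mem hu)
    exact h2.eventually hU
  obtain ⟨ρ, hρ, hρU⟩ := Metric.eventually_nhds_iff_ball.1 hT
  have hsub : Metric.ball u₀ (min r ρ) ⊆ Metric.ball u₀ r :=
    Metric.ball_subset_ball (min_le_left _ _)
  have hsub' : Metric.ball u₀ (min r ρ) ⊆ Metric.ball u₀ ρ :=
    Metric.ball_subset_ball (min_le_right _ _)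
  -- In coordinates, the expansion bound comes from the Lipschitz inverse and the growth bound from
  -- the Lipschitz flow.
  have hmain := uniqueDiffWithinAt_image_ball (u₀ := u₀)
    (f := fun u => extChartAt (𝓡 n) x (projFlow Φ t (lagSection α V q u))) (lt_min hr hρ)
    (A := C) (L := L) ?_ ?_
  · simp only [hu₀x] at hmain
    refine UniqueDiffWithinAt.mono hmain ?_
    rintro _ ⟨u, hu, rfl⟩
    refine ⟨?_, by simp⟩
    rw [mem_preimage, (extChartAt (𝓡 n) x).left_inv (by
      rw [extChartAt_source]; exact hsrc t htδ u (hsub hu))]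
    exact mem_image_of_mem _ (lagSection_mem (hrd (hsub hu)))
  · intro u hu v hv
    have hinv : ∀ w ∈ Metric.ball u₀ (min r ρ),
        cotCoord q (projFlowInv Φ Λ t (projFlow Φ t (lagSection α V q w))) =
          (w, fderiv ℝ (α ∘ (extChartAt (𝓡 n) q).symm) w) := fun w hw => by
      rw [← cotCoord_lagSection hV hα (hrd (hsub hw))]
      exact congrArg _ (hbi.injOn.leftInvOn_invFunOn (lagSection_mem (hrd (hsub hw))))
    have h1 := hC _ (hρU u (hsub' hu)) _ (hρU v (hsub' hv))
    rw [hinv u hu, hinv v hv] at h1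
    exact (le_max_left _ _).trans h1
  · intro u hu
    have h1 := hL.dist_le_mul (t, u) ⟨htδ, hsub hu⟩ (t, u₀) ⟨htδ, Metric.mem_ball_self hr⟩
    have h2 : dist ((t, u) : ℝ × Model n) (t, u₀) = dist u u₀ := by simp [Prod.dist_eq]
    rw [h2] at h1
    exact (le_max_left _ _).trans h1

/-- At the centre of the chart the coordinates of a covector are the covector itself, and unique
differentiability identifies the chosen relative differential. -/
theorem dSection_eq_of_hasMFDerivWithinAt {f : M → ℝ} {S : Set M} {k : Cotangent n M}
    (hk : k.proj = x) (hu : UniqueMDiffWithinAt (𝓡 n) S x)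
    (h : HasMFDerivWithinAt (𝓡 n) 𝓘(ℝ, ℝ) f S x (covCoord x k)) : dSection f S x = k := by
  subst hk
  have h1 := h.mfderivWithin hu
  have h2 : mfderivWithin (𝓡 n) 𝓘(ℝ, ℝ) f S k.proj = k.2 :=
    h1.trans (ContinuousLinearMap.ext fun v => covCoord_self_apply k v)
  rw [dSection, h2]

end Generating

end

/-! ### The generating function of the transported graph -/

theorem lemma3p3 {n : ℕ} {M : Type*} [TopologicalSpace M] [T2Space M] [ParacompactSpace M]
    [ConnectedSpace M] [ChartedSpace (Model n) M] [IsManifold (𝓡 n) ∞ M]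
    -- the open interval of times
    (J : Set ℝ) (hJ : IsOpen J) (hJi : J.OrdConnected) (hJ0 : (0 : ℝ) ∈ J)
    -- `Λ` is the graph of `dα` over a contractible open set
    (V : Set M) (hV : IsOpen V) (hVc : ContractibleSpace V)
    (α : M → ℝ) (hα : ContMDiffOn (𝓡 n) 𝓘(ℝ, ℝ) ∞ α V)
    (Λ : Set (Cotangent n M)) (hΛ : Λ = graphOfDifferential α V)
    -- the Hamiltonian and its flow
    (O : Set (Cotangent n M)) (hO : IsOpen O) (hΛO : Λ ⊆ O)
    (H : ℝ → Cotangent n M → ℝ) (Φ : ℝ → Cotangent n M → Cotangent n M)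
    (hΦ : RegularHamiltonianFlow J O Λ H Φ)
    -- at time `t` the projected flow is bi-Lipschitz
    (t : ℝ) (ht : t ∈ J) (hbi : IsBiLipschitzOn (cotModel n) (𝓡 n) (projFlow Φ t) Λ) :
    (∀ x ∈ projFlow Φ t '' Λ,
      MDifferentiableWithinAt (𝓡 n) 𝓘(ℝ, ℝ) (alphaT α H Φ Λ t) (projFlow Φ t '' Λ) x ∧
      dSection (alphaT α H Φ Λ t) (projFlow Φ t '' Λ) x =
        Φ t (Function.invFunOn (projFlow Φ t) Λ x)) ∧
    ContMDiffOn (𝓡 n) 𝓘(ℝ, ℝ) 1 (alphaT α H Φ Λ t) (projFlow Φ t '' Λ) ∧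
    Φ t '' Λ = graphOfDifferential (alphaT α H Φ Λ t) (projFlow Φ t '' Λ) := by
  subst hΛ
  have hfd := fun x hx =>
    eventually_hasFDerivWithinAt_alphaT (x := x) hV hα hJ hJi hJ0 hΦ ht hbi hx
  have hmem : ∀ x ∈ projFlow Φ t '' graphOfDifferential α V, extChartAt (𝓡 n) x x ∈
      (extChartAt (𝓡 n) x).symm ⁻¹' (projFlow Φ t '' graphOfDifferential α V) := fun x hx => by
    rwa [mem_preimage, extChartAt_to_inv]
  have hcont : ∀ x ∈ projFlow Φ t '' graphOfDifferential α V, ContinuousWithinAt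
      (alphaT α H Φ (graphOfDifferential α V) t) (projFlow Φ t '' graphOfDifferential α V) x := by
    intro x hx
    have h1 := ((hfd x hx).self_of_nhdsWithin (hmem x hx)).continuousWithinAt
    have hsrc : ∀ᶠ y in 𝓝[projFlow Φ t '' graphOfDifferential α V] x,
        (extChartAt (𝓡 n) x).symm (extChartAt (𝓡 n) x y) = y := by
      filter_upwards [mem_nhdsWithin_of_mem_nhds (extChartAt_source_mem_nhds (I := 𝓡 n) x)]
        with y hy
      exact (extChartAt (𝓡 n) x).left_inv hy
    have h2 : Tendsto (extChartAt (𝓡 n) x) (𝓝[projFlow Φ t '' graphOfDifferential α V] x)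
        (𝓝[(extChartAt (𝓡 n) x).symm ⁻¹' (projFlow Φ t '' graphOfDifferential α V)]
          (extChartAt (𝓡 n) x x)) := by
      refine tendsto_nhdsWithin_iff.2 ⟨(continuousAt_extChartAt x).continuousWithinAt, ?_⟩
      filter_upwards [hsrc, self_mem_nhdsWithin] with y hy hyS
      rwa [mem_preimage, hy]
    have h3 := h1.tendsto.comp h2
    rw [Function.comp_apply, extChartAt_to_inv] at h3
    refine h3.congr' ?_
    filter_upwards [hsrc] with y hy
    simp only [Function.comp_apply, hy]
  have hderiv : ∀ x ∈ projFlow Φ t '' graphOfDifferential α V,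
      HasMFDerivWithinAt (𝓡 n) 𝓘(ℝ, ℝ) (alphaT α H Φ (graphOfDifferential α V) t)
        (projFlow Φ t '' graphOfDifferential α V) x
        (covCoord x (Φ t (projFlowInv Φ (graphOfDifferential α V) t x))) := by
    intro x hx
    refine ⟨hcont x hx, ?_⟩
    have h1 := (hfd x hx).self_of_nhdsWithin (hmem x hx)
    rw [extChartAt_to_inv] at h1
    exact h1.mono inter_subset_left
  have hd : ∀ x ∈ projFlow Φ t '' graphOfDifferential α V,
      dSection (alphaT α H Φ (graphOfDifferential α V) t)
        (projFlow Φ t '' graphOfDifferential α V) x =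
        Φ t (projFlowInv Φ (graphOfDifferential α V) t x) := fun x hx =>
    dSection_eq_of_hasMFDerivWithinAt (projFlow_projFlowInv hx)
      (uniqueMDiffWithinAt_image_projFlow hV hα hJ hΦ ht hbi hx) (hderiv x hx)
  have hinv : ∀ ℓ ∈ graphOfDifferential (n := n) α V,
      projFlowInv Φ (graphOfDifferential α V) t (projFlow Φ t ℓ) = ℓ :=
    fun ℓ hℓ => hbi.injOn.leftInvOn_invFunOn hℓ
  refine ⟨fun x hx => ⟨(hderiv x hx).mdifferentiableWithinAt, hd x hx⟩, fun x hx => ?_, ?_⟩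
  · rw [contMDiffWithinAt_iff]
    refine ⟨hcont x hx, ?_⟩
    have hS : (extChartAt (𝓡 n) x).symm ⁻¹' (projFlow Φ t '' graphOfDifferential α V) ∩
        range (𝓡 n) = (extChartAt (𝓡 n) x).symm ⁻¹' (projFlow Φ t '' graphOfDifferential α V) := by
      rw [ModelWithCorners.range_eq_univ, inter_univ]
    rw [hS]
    set S' := (extChartAt (𝓡 n) x).symm ⁻¹' (projFlow Φ t '' graphOfDifferential α V)
    have htgt : (extChartAt (𝓡 n) x).target ∈ 𝓝 (extChartAt (𝓡 n) x x) :=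
      extChartAt_target_mem_nhds x
    have hone : (1 : WithTop ℕ∞) = 0 + 1 := (zero_add 1).symm
    -- The derivative in the chart at `x` is the fibre coordinate of `Φ_t` composed with the inverse
    -- projected flow, so `C^1` reduces to continuity of that composition.
    rw [hone, contDiffWithinAt_succ_iff_hasFDerivWithinAt' (by simp), insert_eq_of_mem (hmem x hx)]
    refine ⟨_, inter_mem (hfd x hx) self_mem_nhdsWithin, inter_subset_right, by simp, _,
      fun u hu => hu.1, ?_⟩
    rw [contDiffWithinAt_zero (hmem x hx)]
    refine ⟨_, mem_nhdsWithin_of_mem_nhds htgt, fun u hu => ?_⟩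
    have hux : (extChartAt (𝓡 n) x).symm u ∈ (chartAt (Model n) x).source := by
      rw [← extChartAt_source (𝓡 n)]
      exact (extChartAt (𝓡 n) x).map_target hu.2
    have h1 := (continuousWithinAt_flow_projFlowInv hΦ ht hbi hu.1).comp
      (continuousAt_extChartAt_symm'' hu.2).continuousWithinAt
      (mapsTo_preimage (extChartAt (𝓡 n) x).symm _)
    have h2 := continuousAt_cotCoord (c := x)
      (k := Φ t (projFlowInv Φ (graphOfDifferential α V) t ((extChartAt (𝓡 n) x).symm u)))
      (by rwa [projFlow_projFlowInv hu.1])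
    exact (continuousAt_snd.comp_continuousWithinAt (h2.comp_continuousWithinAt
      (f := fun u => Φ t (projFlowInv Φ (graphOfDifferential α V) t
        ((extChartAt (𝓡 n) x).symm u))) h1)).mono
      inter_subset_left
  · ext k
    constructor
    · rintro ⟨ℓ, hℓ, rfl⟩
      refine ⟨projFlow Φ t ℓ, mem_image_of_mem _ hℓ, ?_⟩
      rw [hd _ (mem_image_of_mem _ hℓ), hinv ℓ hℓ]
    · rintro ⟨_, ⟨ℓ, hℓ, rfl⟩, rfl⟩
      refine ⟨ℓ, hℓ, ?_⟩
      rw [hd _ (mem_image_of_mem _ hℓ), hinv ℓ hℓ]
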